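/- **Proposition 4.4** (regular polynomials form a holomorphy type). *Complex Banach lattices.* A complex Banach lattice $E$ is the complexification of a real Banach lattice $E_{\mathbb R}$, with modulus $|x+iy|=\sup\{x\cos\theta+y\sin\theta:\theta\in\mathbb R\}$ and norm $\|z\|=\|\,|z|\,\|$; it is Dedekind complete if $E_{\mathbb R}$ is, i.e. if every nonempty subset of $E_{\mathbb R}$ that is bounded above has a supremum. *Regular polynomials.* Let $E,F$ be complex Banach lattices with $F$ Dedekind complete and $m\ge 0$. An $m$-homogeneous polynomial $P\colon E\to F$, $P(x)=A(x,\dots,x)$ with $A$ complex $m$-linear and symmetric, is positive if $A(x_1,\dots,x_m)\ge 0$ for all $x_1,\dots,x_m\ge 0$ (so that $P$ is the complexification of a real polynomial), and regular if $P=P_0+iP_1$ where $P_0,P_1$ are differences of positive $m$-homogeneous polynomials. The space $\mathcal P_r({}^mE;F)$ of regular $m$-homogeneous polynomials is ordered by: $P\le Q$ iff $Q-P$ is positive; it carries the modulus $|P|=\sup\{P_0\cos\theta+P_1\sin\theta:\theta\in\mathbb R\}$ and the regular norm $\|P\|_r=\sup\{\|\,|P|(z)\|:\|z\|\le 1\}$.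 *Derivatives.* $\widehat d^kP(a)(y)=m(m-1)\cdots(m-k+1)\,A(a^{m-k},y^k)$ for $0\le k\le m$. **Claim.** On the class of pairs $(E,F)$ of complex Banach lattices with $F$ Dedekind complete, the sequence $(\mathcal P_r({}^mE;F),\|\cdot\|_r)_{m\ge 0}$ is a holomorphy type in the sense of Nachbin, with constant $\sigma=2e$. That is, for all such $(E,F)$: (a) for every $m$, $\mathcal P_r({}^mE;F)$ with $\|\cdot\|_r$ is a Banach space and is a vector subspace of the space of continuous $m$-homogeneous polynomials from $E$ to $F$; (b) $\mathcal P_r({}^0E;F)$ coincides with $F$ (the constants) as a Banach space; (c) for every $k$, $\mathcal P_r({}^kE;F)$ with the above order, modulus and norm is itself a Dedekind complete complex Banach lattice; and for all $0\le k\le m$ and $P\in\mathcal P_r({}^mE;F)$ one has $\widehat d^kP\in\mathcal P_r\bigl({}^{m-k}E;\mathcal P_r({}^kE;F)\bigr)$ and $$\Bigl\|\tfrac1{k!}\widehat d^kP(a)\Bigr\|_r\le (2e)^m\,\|P\|_r\,\|a\|^{m-k}\qquad\text{for all } a\in E .$$ -/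

import Mathlib

universe u

/-! ### Banach lattices -/

/-- A (real) Banach lattice. -/
class RealBanachLattice (R : Type u) extends NormedAddCommGroup R, NormedSpace ℝ R, Lattice R,
    IsOrderedAddMonoid R, PosSMulMono ℝ R, HasSolidNorm R, CompleteSpace R

/-- `IsSup C S w`: `w` is the least upper bound of `S` for the relation `x ≤ y ↔ y - x ∈ C`. -/
def IsSup {V : Type u} [AddCommGroup V] [Module ℂ V] (C : PointedCone ℝ V) (S : Set V) (w : V) :
    Prop :=
  (∀ x ∈ S, w - x ∈ C) ∧ ∀ v : V, (∀ x ∈ S, v - x ∈ C) → v - w ∈ C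

/-- The real part of a complex vector space with a positive cone: the real linear span of the
cone. -/
def realSpan {V : Type u} [AddCommGroup V] [Module ℂ V] (C : PointedCone ℝ V) : Submodule ℝ V :=
  Submodule.span ℝ (C : Set V)

/-- `IsModulus C z w`: `w` is the modulus of `z`, i.e. `z = x + i y` with `x`, `y` in the real part
and `w = sup {x cos θ + y sin θ}`. -/
def IsModulus {V : Type u} [AddCommGroup V] [Module ℂ V] (C : PointedCone ℝ V) (z w : V) : Prop :=
  ∃ x ∈ realSpan C, ∃ y ∈ realSpan C, z = x + Complex.I • y ∧
    IsSup C (Set.range fun θ : ℝ => Real.cos θ • x + Real.sin θ • y) w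

/-- The data of a complex normed space together with a positive cone. No law relating the norm to
the rest is imposed here: the laws are the predicates `IsBanach` and `IsComplexBanachLattice`. -/
structure ConeSpace : Type (u + 1) where
  carrier : Type u
  [addCommGroup : AddCommGroup carrier]
  [module : Module ℂ carrier]
  [norm : Norm carrier]
  pos : PointedCone ℝ carrier

instance : CoeSort ConeSpace.{u} (Type u) := ⟨ConeSpace.carrier⟩

attribute [instance] ConeSpace.addCommGroup ConeSpace.module ConeSpace.norm

/-- The underlying normed space is a complex Banach space: the norm axioms hold and Cauchy
sequences converge. -/
structure IsBanach (E : ConeSpace.{u}) : Prop where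
  core : NormedSpace.Core ℂ E
  complete : ∀ s : ℕ → E,
    (∀ ε : ℝ, 0 < ε → ∃ N : ℕ, ∀ i ≥ N, ∀ j ≥ N, ‖s i - s j‖ < ε) →
      ∃ l : E, ∀ ε : ℝ, 0 < ε → ∃ N : ℕ, ∀ i ≥ N, ‖s i - l‖ < ε

/-- `E` is a complex Banach lattice: it is the complexification of a real Banach lattice `R`, with
the positive cone of `R` and with the norm `‖z‖ = ‖ |z| ‖`, where
`|x + i y| = sup {x cos θ + y sin θ}`. -/
def IsComplexBanachLattice (E : ConeSpace.{u}) : Prop :=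
  ∃ (R : Type u) (_ : RealBanachLattice R) (ι : R →ₗ[ℝ] E),
    (∀ z : E, ∃! p : R × R, z = ι p.1 + Complex.I • ι p.2) ∧
    (∀ z : E, z ∈ E.pos ↔ ∃ x : R, 0 ≤ x ∧ ι x = z) ∧
    ∀ x y : R, ∃ r : R,
      IsLUB (Set.range fun θ : ℝ => Real.cos θ • x + Real.sin θ • y) r ∧
        ‖ι x + Complex.I • ι y‖ = ‖r‖

/-- Dedekind completeness: every nonempty subset of the real part that is bounded above has a
least upper bound. -/
def IsDedekindComplete (F : ConeSpace.{u}) : Prop :=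
  ∀ S : Set F, S ⊆ realSpan F.pos → S.Nonempty → (∃ b ∈ realSpan F.pos, ∀ x ∈ S, b - x ∈ F.pos) →
    ∃ w ∈ realSpan F.pos, IsSup F.pos S w

/-! ### Homogeneous polynomials -/

/-- `A` is symmetric and generates `P`, i.e. `P x = A (x, …, x)`. -/
def Generates {m : ℕ} {E F : ConeSpace.{u}} (A : MultilinearMap ℂ (fun _ : Fin m => E) F)
    (P : E → F) : Prop :=
  (∀ (π : Equiv.Perm (Fin m)) (x : Fin m → E), A (fun i => x (π i)) = A x) ∧
    ∀ x : E, P x = A fun _ => x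

/-- `P` is a continuous (equivalently, bounded) `m`-homogeneous polynomial. -/
def IsContHomPoly (m : ℕ) (E F : ConeSpace.{u}) (P : E → F) : Prop :=
  (∃ A : MultilinearMap ℂ (fun _ : Fin m => E) F, Generates A P) ∧
    ∃ C : ℝ, ∀ x : E, ‖P x‖ ≤ C * ‖x‖ ^ m

/-- The value `(d̂ᵏ P (a)) (y) = m (m - 1) ⋯ (m - k + 1) A (a^(m-k), y^k)` of the `k`-th derivative
of the `m`-homogeneous polynomial `P` generated by the symmetric multilinear map `A`. -/
def polyDeriv {m : ℕ} {E F : ConeSpace.{u}} (k : ℕ)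
    (A : MultilinearMap ℂ (fun _ : Fin m => E) F) (a y : E) : F :=
  (m.descFactorial k : ℂ) • A fun i => if i.val < m - k then a else y

/-! ### Holomorphy types -/

/-- A complex vector space of functions from `E` to `F`, equipped with a norm and a cone. -/
structure FunSpace (E F : ConeSpace.{u}) where
  space : Submodule ℂ (E → F)
  norm : space → ℝ
  pos : PointedCone ℝ space

/-- A `FunSpace` regarded as a space in its own right. -/
def FunSpace.toConeSpace {E F : ConeSpace.{u}} (Θ : FunSpace E F) : ConeSpace.{u} where
  carrier := Θ.space
  norm := ⟨Θ.norm⟩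
  pos := Θ.pos

/-- `Θ` is a holomorphy type, with constant `σ`, on the class `B` of pairs of Banach spaces; here
`Θ E F m` is the space of `m`-homogeneous polynomials of type `Θ` from `E` to `F`. The cones are
carried along so that the class `B` may refer to a lattice structure. -/
structure IsHolomorphyType (B : ConeSpace.{u} → ConeSpace.{u} → Prop)
    (Θ : ∀ E F : ConeSpace.{u}, ℕ → FunSpace E F) (σ : ℝ) : Prop where
  /-- `B` is a class of pairs of Banach spaces. -/
  banach_pair : ∀ E F, B E F → IsBanach E ∧ IsBanach F
  /-- Each `Θ E F m` is a Banach space. -/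
  banach : ∀ E F, B E F → ∀ m, IsBanach (Θ E F m).toConeSpace
  /-- Each `Θ E F m` is a subspace of the continuous `m`-homogeneous polynomials. -/
  subspace : ∀ E F, B E F → ∀ m, ∀ P ∈ (Θ E F m).space, IsContHomPoly m E F P
  /-- `Θ E F 0` is the space of constants. -/
  zero_mem : ∀ E F, B E F → ∀ P : E → F, P ∈ (Θ E F 0).space ↔ ∃ c : F, P = fun _ => c
  /-- The norm of a constant in `Θ E F 0` is its norm in `F`. -/
  zero_norm : ∀ E F, B E F → ∀ (P : (Θ E F 0).space) (c : F), (P : E → F) = (fun _ => c) →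
    (Θ E F 0).norm P = ‖c‖
  /-- The spaces `Θ E F k` are again admissible as target spaces. -/
  closed : ∀ E F, B E F → ∀ k, B E (Θ E F k).toConeSpace
  one_le : 1 ≤ σ
  /-- For `P` in `Θ E F m` and `k ≤ m`, the derivative `D = d̂ᵏ P` belongs to
  `Θ E (Θ E F k) (m - k)` and `‖(1 / k!) D a‖ ≤ σ ^ m ‖P‖ ‖a‖ ^ (m - k)`. -/
  deriv : ∀ E F, B E F → ∀ m k : ℕ, k ≤ m → ∀ (P : (Θ E F m).space)
    (A : MultilinearMap ℂ (fun _ : Fin m => E) F), Generates A (P : E → F) →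
      ∃ D : E → (Θ E F k).space,
        (∀ a y : E, (D a : E → F) y = polyDeriv k A a y) ∧
        D ∈ (Θ E (Θ E F k).toConeSpace (m - k)).space ∧
        ∀ a : E, (Θ E F k).norm ((1 / (k.factorial : ℂ)) • D a) ≤
          σ ^ m * (Θ E F m).norm P * ‖a‖ ^ (m - k)

/-! ### Regular polynomials -/

/-- The cone of positive `m`-homogeneous polynomials: those whose generating symmetric multilinear
map takes positive values at positive arguments. (Such a map sends real arguments to real values,
hence is the complexification of a real one.) -/
def posPoly (m : ℕ) (E F : ConeSpace.{u}) : PointedCone ℝ (E → F) where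
  carrier := {P | ∃ A : MultilinearMap ℂ (fun _ : Fin m => E) F, Generates A P ∧
    ∀ x : Fin m → E, (∀ i, x i ∈ E.pos) → A x ∈ F.pos}
  zero_mem' := ⟨0, ⟨fun _ _ => rfl, fun _ => rfl⟩, fun _ _ => F.pos.zero_mem⟩
  add_mem' := by
    rintro P Q ⟨A, ⟨hA, hP⟩, hA0⟩ ⟨B, ⟨hB, hQ⟩, hB0⟩
    refine ⟨A + B, ⟨fun π x => ?_, fun x => ?_⟩, fun x hx => ?_⟩
    · simp only [add_apply, hA, hB]
    · simp only [add_apply, Pi.add_apply, hP, hQ]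
    · exact F.pos.add_mem (hA0 x hx) (hB0 x hx)
  smul_mem' := by
    rintro c P ⟨A, ⟨hA, hP⟩, hA0⟩
    refine ⟨((c : ℝ) : ℂ) • A, ⟨fun π x => ?_, fun x => ?_⟩, fun x hx => ?_⟩
    · simp only [smul_apply, hA]
    · rw [Pi.smul_apply, hP]; rfl
    · exact F.pos.smul_mem c.2 (hA0 x hx)

/-- A regular real polynomial: a difference of two positive polynomials. -/
def IsRealRegular (m : ℕ) (E F : ConeSpace.{u}) (P : E → F) : Prop :=
  ∃ P₁ ∈ posPoly m E F, ∃ P₂ ∈ posPoly m E F, P = P₁ - P₂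

theorem IsRealRegular.add {m : ℕ} {E F : ConeSpace.{u}} {P Q : E → F}
    (hP : IsRealRegular m E F P) (hQ : IsRealRegular m E F Q) : IsRealRegular m E F (P + Q) := by
  obtain ⟨P₁, h1, P₂, h2, rfl⟩ := hP
  obtain ⟨Q₁, h3, Q₂, h4, rfl⟩ := hQ
  exact ⟨P₁ + Q₁, add_mem h1 h3, P₂ + Q₂, add_mem h2 h4, by abel⟩

theorem IsRealRegular.smul {m : ℕ} {E F : ConeSpace.{u}} {P : E → F} (c : ℝ)
    (hP : IsRealRegular m E F P) : IsRealRegular m E F (c • P) := by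
  obtain ⟨P₁, h1, P₂, h2, rfl⟩ := hP
  rcases le_total 0 c with hc | hc
  · exact ⟨c • P₁, (posPoly m E F).smul_mem hc h1, c • P₂,
      (posPoly m E F).smul_mem hc h2, smul_sub _ _ _⟩
  · have hc' : 0 ≤ -c := neg_nonneg.mpr hc
    refine ⟨(-c) • P₂, (posPoly m E F).smul_mem hc' h2, (-c) • P₁,
      (posPoly m E F).smul_mem hc' h1, ?_⟩
    rw [smul_sub, neg_smul, neg_smul]; abel

/-- The regular `m`-homogeneous polynomials: `P = P₀ + i P₁`, where the real and imaginary parts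
`P₀`, `P₁` are regular real polynomials. -/
noncomputable def regPoly (m : ℕ) (E F : ConeSpace.{u}) : Submodule ℂ (E → F) where
  carrier := {P | ∃ P₀ P₁ : E → F, IsRealRegular m E F P₀ ∧ IsRealRegular m E F P₁ ∧
    P = P₀ + Complex.I • P₁}
  zero_mem' := by
    have h : IsRealRegular m E F 0 := ⟨0, zero_mem _, 0, zero_mem _, (sub_zero _).symm⟩
    exact ⟨0, 0, h, h, by simp⟩
  add_mem' := by
    rintro P Q ⟨P₀, P₁, h0, h1, rfl⟩ ⟨Q₀, Q₁, h2, h3, rfl⟩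
    exact ⟨P₀ + Q₀, P₁ + Q₁, h0.add h2, h1.add h3, by rw [smul_add]; abel⟩
  smul_mem' := by
    rintro c P ⟨P₀, P₁, h0, h1, rfl⟩
    refine ⟨c.re • P₀ + (-c.im) • P₁, c.im • P₀ + c.re • P₁, (h0.smul _).add (h1.smul _),
      (h0.smul _).add (h1.smul _), ?_⟩
    have hr : ∀ (t : ℝ) (R : E → F), t • R = (t : ℂ) • R := fun _ _ => rfl
    have hc : c = (c.re : ℂ) + c.im * Complex.I := (Complex.re_add_im c).symm
    simp only [hr, smul_add, smul_smul]
    conv_lhs => rw [hc]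
    simp only [add_smul, add_mul, mul_assoc, Complex.I_mul_I, Complex.ofReal_neg]
    rw [mul_comm Complex.I (c.im : ℂ), mul_comm Complex.I (c.re : ℂ), mul_neg_one]
    abel

/-- The positive cone of the space of regular polynomials, so that `P ≤ Q` means that `Q - P` is
positive. -/
noncomputable def regPolyPos (m : ℕ) (E F : ConeSpace.{u}) : PointedCone ℝ (regPoly m E F) :=
  (posPoly m E F).comap ((regPoly m E F).subtype.restrictScalars ℝ)

/-- The supremum norm over the closed unit ball. -/
noncomputable def supNorm {E F : ConeSpace.{u}} (P : E → F) : ℝ :=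
  sSup {r : ℝ | ∃ z : E, ‖z‖ ≤ 1 ∧ r = ‖P z‖}

open Classical in
/-- The regular norm `‖P‖ᵣ = ‖ |P| ‖`: the supremum norm of the modulus `|P|` of `P` in the space
of regular polynomials. -/
noncomputable def regNorm (m : ℕ) (E F : ConeSpace.{u}) (P : regPoly m E F) : ℝ :=
  if h : ∃ Q : regPoly m E F, IsModulus (regPolyPos m E F) P Q then supNorm (h.choose : E → F)
  else 0

/-- The regular `m`-homogeneous polynomials from `E` to `F`, with the regular norm. -/
noncomputable def regularPolynomials (E F : ConeSpace.{u}) (m : ℕ) : FunSpace E F where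
  space := regPoly m E F
  norm := regNorm m E F
  pos := regPolyPos m E F

/-- The pairs `(E, F)` of complex Banach lattices with `F` Dedekind complete. -/
def LatticePair (E F : ConeSpace.{u}) : Prop :=
  IsComplexBanachLattice E ∧ IsComplexBanachLattice F ∧ IsDedekindComplete F

/-! Two facts about the order carry the theorem.

The first is order completeness. Multilinear maps `Eᵐ → F` that are positive at positive arguments
form a cone. If `F` is Dedekind complete, every nonempty family with an upper bound has a supremum
for this cone: currying reduces the claim to linear maps (`IsOrderComplete.positiveMaps`), where it
is the Riesz–Kantorovich theorem. The supremum of symmetric maps is symmetric by uniqueness, so the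
regular polynomials inherit order completeness and have moduli. A general criterion
(`isComplexBanachLattice_of_cone`) then makes them a complex Banach lattice. Its norm is the
supremum norm on positive polynomials, which are automatically bounded; completeness comes from
summing series of positive polynomials.

The second is the modulus inequality `|A (z₁, …, zₘ)| ≤ B (|z₁|, …, |zₘ|)` whenever `|A| ≤ B` on
positive arguments (`Dominates.map_multilinear`). Each `z` is written as a finite sum `∑ exp (i tⱼ)
cⱼ` with `cⱼ ≥ 0` and `∑ cⱼ ≤ (1 + ε) |z|`, after which `A` is expanded and `ε` tends to `0`. This
approximate polar decomposition is a finite system of linear inequalities in a vector lattice,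
solved by a Farkas lemma, so no representation theorem for lattices is used.

For the derivative, let `Q = |P|` have symmetric form `B`, and take `w, v ≥ 0` of norm at most `1`.
Positivity gives `B (w^(m-k), v^k) ≤ Q (w + v)`, of norm at most `2 ^ m ‖Q‖`. The coefficient
`m.choose k` costs another `2 ^ m`, and `4 ≤ 2e`. -/

/-! ### Algebra of multilinear maps -/

section Multilinear

variable {K V W : Type*} [Field K] [AddCommGroup V] [Module K V] [AddCommGroup W] [Module K W]

/-- A multilinear map with values in a submodule on a spanning set takes all its values there. -/
theorem MultilinearMap.mem_of_span {ι : Type*} [Finite ι]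
    (f : MultilinearMap K (fun _ : ι => V) W) (S : Set V) (hS : Submodule.span K S = ⊤)
    (p : Submodule K W) (h : ∀ x : ι → V, (∀ i, x i ∈ S) → f x ∈ p) (x : ι → V) : f x ∈ p := by
  classical
  cases nonempty_fintype ι
  suffices H : ∀ t : Finset ι, ∀ x : ι → V, (∀ i ∉ t, x i ∈ S) → f x ∈ p from
    H Finset.univ x (fun i hi => absurd (Finset.mem_univ i) hi)
  intro t
  induction t using Finset.induction_on with
  | empty => exact fun x hx => h x fun i => hx i (Finset.notMem_empty i)
  | insert a t ha ih =>
    intro x hx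
    have key : ∀ v ∈ Submodule.span K S, f (Function.update x a v) ∈ p := by
      intro v hv
      induction hv using Submodule.span_induction with
      | mem v hv =>
        refine ih _ fun i hi => ?_
        by_cases hia : i = a
        · subst hia; simpa using hv
        · rw [Function.update_of_ne hia]
          exact hx i (by simp [hia, hi])
      | zero => rw [f.map_update_zero]; exact p.zero_mem
      | add v w _ _ hv hw => rw [f.map_update_add]; exact p.add_mem hv hw
      | smul c v _ hv => rw [f.map_update_smul]; exact p.smul_mem c hv
    have := key (x a) (hS ▸ Submodule.mem_top)
    rwa [Function.update_eq_self] at this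

theorem MultilinearMap.eq_zero_of_span {ι : Type*} [Finite ι]
    (f : MultilinearMap K (fun _ : ι => V) W) (S : Set V) (hS : Submodule.span K S = ⊤)
    (h : ∀ x : ι → V, (∀ i, x i ∈ S) → f x = 0) : f = 0 := by
  ext x
  exact (Submodule.mem_bot K).1 (f.mem_of_span S hS ⊥ (fun x hx => (Submodule.mem_bot K).2 (h x hx)) x)

/-- Flipping the sign at an index missed by `r` negates the first product and leaves the second
alone, so the terms cancel in pairs. -/
theorem sum_signs_eq_zero {m : ℕ} (r : Fin m → Fin m) (hr : ¬ Function.Surjective r) :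
    ∑ e : Fin m → Bool, ((∏ i, (if e i then (1 : K) else -1)) *
      ∏ j, (if e (r j) then (1 : K) else -1)) = 0 := by
  classical
  obtain ⟨i₀, hi₀⟩ := not_forall.1 hr
  push Not at hi₀
  have hinv : Function.Involutive fun e : Fin m → Bool => Function.update e i₀ (!(e i₀)) := by
    intro e; simp
  refine Finset.sum_involution (fun e _ => Function.update e i₀ (!(e i₀))) ?_ ?_ ?_ ?_
  · intro e _
    have h1 : ∏ j, (if Function.update e i₀ (!(e i₀)) (r j) then (1 : K) else -1)
        = ∏ j, (if e (r j) then (1 : K) else -1) :=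
      Finset.prod_congr rfl fun j _ => by rw [Function.update_of_ne (hi₀ j)]
    have h2 : ∏ i, (if Function.update e i₀ (!(e i₀)) i then (1 : K) else -1)
        = - ∏ i, (if e i then (1 : K) else -1) := by
      rw [← Finset.mul_prod_erase _ _ (Finset.mem_univ i₀),
        ← Finset.mul_prod_erase _ (fun i => if e i then (1 : K) else -1) (Finset.mem_univ i₀)]
      have : ∏ i ∈ Finset.univ.erase i₀, (if Function.update e i₀ (!(e i₀)) i then (1 : K) else -1)
          = ∏ i ∈ Finset.univ.erase i₀, (if e i then (1 : K) else -1) :=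
        Finset.prod_congr rfl fun j hj => by
          rw [Function.update_of_ne (Finset.ne_of_mem_erase hj)]
      rw [this, Function.update_self]
      cases e i₀ <;> simp
    rw [h1, h2]; ring
  · intro e _ _ h
    have := congrFun h i₀
    simp at this
  · intros; exact Finset.mem_univ _
  · intro e _; exact hinv e

/-- A symmetric multilinear map is determined by its restriction to the diagonal. -/
theorem MultilinearMap.eq_zero_of_diagonal [CharZero K] {m : ℕ}
    (f : MultilinearMap K (fun _ : Fin m => V) W)
    (hsymm : ∀ (π : Equiv.Perm (Fin m)) (x : Fin m → V), f (fun i => x (π i)) = f x)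
    (h : ∀ x : V, f (fun _ => x) = 0) : f = 0 := by
  classical
  ext x
  let s : Bool → K := fun b => if b then 1 else -1
  -- Polarization: after expansion only the permutations `r` survive, and by symmetry each
  -- contributes `2 ^ m • f x`.
  have h1 : ∑ e : Fin m → Bool, (∏ i, s (e i)) • f (fun _ => ∑ i, s (e i) • x i) = 0 :=
    Finset.sum_eq_zero fun e _ => by rw [h, smul_zero]
  have h2 : ∀ e : Fin m → Bool, f (fun _ => ∑ i, s (e i) • x i)
      = ∑ r : Fin m → Fin m, (∏ j, s (e (r j))) • f (fun j => x (r j)) := by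
    intro e
    rw [f.map_sum (fun _ i => s (e i) • x i)]
    exact Finset.sum_congr rfl fun r _ => f.map_smul_univ (fun j => s (e (r j))) (fun j => x (r j))
  simp only [h2, Finset.smul_sum, smul_smul] at h1
  rw [Finset.sum_comm] at h1
  simp only [← Finset.sum_smul] at h1
  have h3 : ∀ r : Fin m → Fin m, (∑ e : Fin m → Bool, (∏ i, s (e i)) * ∏ j, s (e (r j))) •
      f (fun j => x (r j)) = (if Function.Bijective r then (2 : K) ^ m else 0) • f x := by
    intro r
    by_cases hr : Function.Surjective r
    · have hb : Function.Bijective r := Finite.surjective_iff_bijective.1 hr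
      have hp : ∀ e : Fin m → Bool, ∏ j, s (e (r j)) = ∏ i, s (e i) := fun e =>
        (Equiv.ofBijective r hb).prod_comp fun i => s (e i)
      have hs : ∀ b, s b * s b = 1 := by intro b; cases b <;> simp [s]
      simp only [hp, ← Finset.prod_mul_distrib, hs, if_pos hb]
      rw [← hsymm (Equiv.ofBijective r hb) x]
      simp
    · rw [if_neg fun hb => hr hb.2, zero_smul]
      have := sum_signs_eq_zero (K := K) r hr
      simp only [s, this, zero_smul]
  simp only [h3, ← Finset.sum_smul] at h1
  rcases smul_eq_zero.1 h1 with h4 | h4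
  · exfalso
    rw [← Finset.sum_filter, Finset.sum_const, nsmul_eq_mul] at h4
    have h5 : (Finset.univ.filter fun r : Fin m → Fin m => Function.Bijective r).card ≠ 0 :=
      Finset.card_ne_zero.2 ⟨id, Finset.mem_filter.2 ⟨Finset.mem_univ _, Function.bijective_id⟩⟩
    exact mul_ne_zero (Nat.cast_ne_zero.2 h5) (pow_ne_zero _ two_ne_zero) h4
  · simpa using h4

end Multilinear

/-! ### Linear inequalities in vector lattices -/

section VectorLattice

/-- The Riesz decomposition property. -/
theorem riesz_decomposition {R : Type*} [AddCommGroup R] [Lattice R]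
    [IsOrderedAddMonoid R] {x y a b : R} (hx : 0 ≤ x) (hy : 0 ≤ y) (ha : 0 ≤ a) (hb : 0 ≤ b)
    (h : x + y = a + b) : ∃ p q r s : R, 0 ≤ p ∧ 0 ≤ q ∧ 0 ≤ r ∧ 0 ≤ s ∧
      x = p + q ∧ y = r + s ∧ a = p + r ∧ b = q + s := by
  -- Once `p = x ⊓ a` is chosen the other three are forced; only the sign of the last needs an
  -- argument, namely `x - b ≤ x ⊓ a`.
  refine ⟨x ⊓ a, x - x ⊓ a, a - x ⊓ a, y - (a - x ⊓ a), le_inf hx ha,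
    sub_nonneg.2 inf_le_left, sub_nonneg.2 inf_le_right, ?_, by abel, by abel, by abel, ?_⟩
  · have h2 : y - (a - x ⊓ a) = (b - x) + x ⊓ a := by
      rw [show y = a + b - x by rw [← h]; abel]; abel
    rw [h2, ← sub_le_iff_le_add, zero_sub, neg_le, neg_sub]
    have h3 : x - b ≤ a := by rw [sub_le_iff_le_add, ← h]; exact le_add_of_nonneg_right hy
    exact le_inf (sub_le_self _ hb) h3
  · rw [show b = x + y - a by rw [h]; abel]; abel

/-- Between finitely many lower bounds and finitely many upper bounds there is an element. -/
theorem exists_between_finite {R : Type*} [AddCommGroup R] [Lattice R] {ι κ : Type*} [Finite ι] [Finite κ] (l : ι → R) (u : κ → R)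
    (h : ∀ i j, l i ≤ u j) : ∃ c : R, (∀ i, l i ≤ c) ∧ ∀ j, c ≤ u j := by
  cases nonempty_fintype ι
  cases nonempty_fintype κ
  rcases isEmpty_or_nonempty ι with hι | hι
  · rcases isEmpty_or_nonempty κ with hκ | hκ
    · exact ⟨0, fun i => isEmptyElim i, fun j => isEmptyElim j⟩
    · exact ⟨Finset.univ.inf' Finset.univ_nonempty u, fun i => isEmptyElim i,
        fun j => Finset.inf'_le _ (Finset.mem_univ j)⟩
  · exact ⟨Finset.univ.sup' Finset.univ_nonempty l,
      fun i => Finset.le_sup' _ (Finset.mem_univ i), fun j => Finset.sup'_le _ _ fun i _ => h i j⟩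

variable {R : Type*} [AddCommGroup R] [Lattice R] [IsOrderedAddMonoid R] [Module ℝ R]
  [PosSMulMono ℝ R]

/-- Farkas' lemma in a vector lattice: a finite system of linear inequalities with right hand sides
in the lattice is solvable if no nonnegative combination of the inequalities is contradictory. -/
theorem exists_solution_of_certificates {n : ℕ} : ∀ {ι : Type} [Fintype ι] (a : ι → Fin n → ℝ)
    (b : ι → R), (∀ l : ι → ℝ, (∀ i, 0 ≤ l i) → (∀ j, ∑ i, l i * a i j = 0) →
      0 ≤ ∑ i, l i • b i) → ∃ c : Fin n → R, ∀ i, ∑ j, a i j • c j ≤ b i := by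
  classical
  -- `sg i t` is `t` times the `i`-th unit vector.
  let sg : ∀ {ι : Type}, ι → ℝ → ι → ℝ := fun i t j => if j = i then t else 0
  have hsg : ∀ {ι : Type} (i : ι) {t : ℝ}, 0 ≤ t → ∀ j, 0 ≤ sg i t j := by
    intro ι i t ht j; simp only [sg]; split_ifs <;> simp [ht]
  induction n with
  | zero =>
    intro ι _ a b h
    refine ⟨fun j => j.elim0, fun i => ?_⟩
    have := h (sg i 1) (hsg i zero_le_one) (fun j => j.elim0)
    simpa [sg] using this
  | succ n ih =>
    intro ι _ a b h
    let Z := {i : ι // a i 0 = 0}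
    let P := {i : ι // 0 < a i 0}
    let N := {i : ι // a i 0 < 0}
    -- Fourier–Motzkin elimination of the variable `0`: rows not involving it are kept, and each
    -- positive row is paired with each negative one, with multipliers that cancel it.
    let coef : Z ⊕ (P × N) → ι → ℝ := fun k => match k with
      | Sum.inl z => sg z.1 1
      | Sum.inr (p, q) => sg p.1 (-a q.1 0) + sg q.1 (a p.1 0)
    have hcoef : ∀ k i, 0 ≤ coef k i := by
      rintro (z | ⟨p, q⟩) i
      · exact hsg _ zero_le_one i
      · exact add_nonneg (hsg _ (neg_nonneg.2 q.2.le) i)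
          (hsg _ p.2.le i)
    have hsum1 : ∀ (i : ι) (t : ℝ) (g : ι → ℝ), ∑ j, sg i t j * g j = t * g i := by
      intro i t g
      simp [sg]
    have hsum2 : ∀ (i : ι) (t : ℝ) (g : ι → R),
        ∑ j, sg i t j • g j = t • g i := by
      intro i t g
      simp [sg]
    have h0 : ∀ k, ∑ i, coef k i * a i 0 = 0 := by
      rintro (z | ⟨p, q⟩)
      · simp only [coef, hsum1, z.2, mul_zero]
      · simp only [coef, Pi.add_apply, add_mul, Finset.sum_add_distrib, hsum1]; ring
    obtain ⟨c, hc⟩ := ih (fun k j => ∑ i, coef k i * a i j.succ) (fun k => ∑ i, coef k i • b i) (by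
      intro l hl hz
      -- A certificate for the reduced system pulls back along `coef` to one for the original
      -- system.
      have := h (fun i => ∑ k, l k * coef k i)
        (fun i => Finset.sum_nonneg fun k _ => mul_nonneg (hl k) (hcoef k i)) (by
          intro j
          simp only [Finset.sum_mul]
          rw [Finset.sum_comm]
          simp only [mul_assoc, ← Finset.mul_sum]
          refine Fin.cases ?_ (fun j => ?_) j
          · simp [h0]
          · exact hz j)
      simp only [Finset.sum_smul] at this
      rw [Finset.sum_comm] at this
      simpa only [mul_smul, ← Finset.smul_sum] using this)
    let r : ι → R := fun i => b i - ∑ j : Fin n, a i j.succ • c j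
    have hr : ∀ k, 0 ≤ ∑ i, coef k i • r i := by
      intro k
      have := sub_nonneg.2 (hc k)
      convert this using 1
      simp only [r, smul_sub, Finset.sum_sub_distrib, Finset.sum_smul, Finset.smul_sum, smul_smul]
      rw [Finset.sum_comm]
    -- Negative rows bound the eliminated variable from below, positive rows from above; finitely
    -- many bounds need only lattice operations.
    obtain ⟨c₀, hl, hu⟩ := exists_between_finite (fun q : N => (a q.1 0)⁻¹ • r q.1)
      (fun p : P => (a p.1 0)⁻¹ • r p.1) (by
        intro q p
        have h1 := hr (Sum.inr (p, q))
        simp only [coef, Pi.add_apply, add_smul, Finset.sum_add_distrib, hsum2] at h1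
        have hp := p.2
        have hq := q.2
        have hq0 := hq.ne
        have h2 := smul_nonneg (inv_nonneg.2 (mul_nonneg hp.le (neg_nonneg.2 hq.le))) h1
        rw [← sub_nonneg]
        convert h2 using 1
        rw [smul_add, smul_smul, smul_smul, sub_eq_add_neg, ← neg_smul]
        congr 2
        · field_simp
        · field_simp)
    refine ⟨Fin.cons c₀ c, fun i => ?_⟩
    rw [Fin.sum_univ_succ]
    simp only [Fin.cons_zero, Fin.cons_succ]
    rw [← le_sub_iff_add_le]
    change a i 0 • c₀ ≤ r i
    rcases lt_trichotomy (a i 0) 0 with hi | hi | hi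
    · have := smul_le_smul_of_nonneg_left (hl ⟨i, hi⟩) (neg_nonneg.2 hi.le)
      rw [smul_smul, neg_mul, mul_inv_cancel₀ hi.ne, neg_smul, neg_smul, one_smul,
        neg_le_neg_iff] at this
      exact this
    · have := hr (Sum.inl ⟨i, hi⟩)
      simp only [coef, hsum2, one_smul] at this
      rw [hi, zero_smul]
      exact this
    · have := smul_le_smul_of_nonneg_left (hu ⟨i, hi⟩) hi.le
      rw [smul_smul, mul_inv_cancel₀ hi.ne', one_smul] at this
      exact this

/-- A finite net of radius `min δ 1` suffices, since `cos s ≥ 1 - s² / 2` and a radius at most `1`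
bounds its own square. -/
theorem exists_angles {δ : ℝ} (hδ : 0 < δ) : ∃ (n : ℕ) (t : Fin n → ℝ),
    ∀ φ : ℝ, -Real.pi ≤ φ → φ ≤ Real.pi → ∃ j, 1 - δ ≤ Real.cos (φ - t j) := by
  have hη : 0 < min δ 1 := lt_min hδ one_pos
  obtain ⟨s, -, hs, hcov⟩ := (isCompact_Icc (a := -Real.pi) (b := Real.pi)).finite_cover_balls hη
  obtain ⟨n, e⟩ := (hs.to_subtype : Finite s).exists_equiv_fin
  obtain ⟨e⟩ := e
  refine ⟨n, fun j => (e.symm j : ℝ), fun φ h1 h2 => ?_⟩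
  obtain ⟨x, hx, hφ⟩ := Set.mem_iUnion₂.1 (hcov ⟨h1, h2⟩)
  refine ⟨e ⟨x, hx⟩, ?_⟩
  simp only [e.symm_apply_apply]
  rw [Metric.mem_ball, Real.dist_eq] at hφ
  have h3 := Real.one_sub_sq_div_two_le_cos (x := φ - x)
  have h4 : (φ - x) ^ 2 ≤ min δ 1 := by
    rw [← sq_abs]
    have := min_le_right δ 1
    nlinarith [abs_nonneg (φ - x)]
  have := min_le_left δ 1
  linarith

/-- An approximate polar decomposition of `x + i y` in a vector lattice. -/
theorem exists_polar_decomposition {x y u : R}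
    (h : ∀ t : ℝ, Real.cos t • x + Real.sin t • y ≤ u) {ε : ℝ} (hε : 0 < ε) :
    ∃ (n : ℕ) (t : Fin n → ℝ) (c : Fin n → R), (∀ j, 0 ≤ c j) ∧
      x = ∑ j, Real.cos (t j) • c j ∧ y = ∑ j, Real.sin (t j) • c j ∧
      ∑ j, c j ≤ (1 + ε) • u := by
  have hu : 0 ≤ u := by
    have h1 := h 0
    have h2 := h Real.pi
    simp only [Real.cos_zero, Real.sin_zero, one_smul, zero_smul, add_zero, Real.cos_pi,
      Real.sin_pi, neg_smul] at h1 h2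
    have h3 := add_le_add h1 h2
    rw [add_neg_cancel, ← two_smul ℝ u] at h3
    have := smul_le_smul_of_nonneg_left h3 (show (0 : ℝ) ≤ 1 / 2 by norm_num)
    rw [smul_smul] at this
    simpa using this
  -- This `δ` makes `1 - δ = (1 + ε)⁻¹`.
  obtain ⟨n, t, ht⟩ := exists_angles (δ := ε / (1 + ε)) (by positivity)
  -- The unknowns are the `cⱼ`. Rows `0`–`3` encode the two equations as pairs of inequalities, row
  -- `4` the bound on the sum, and the remaining rows `cⱼ ≥ 0`.
  let a : Fin 5 ⊕ Fin n → Fin n → ℝ := fun k j => match k with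
    | Sum.inl 0 => Real.cos (t j)
    | Sum.inl 1 => -Real.cos (t j)
    | Sum.inl 2 => Real.sin (t j)
    | Sum.inl 3 => -Real.sin (t j)
    | Sum.inl 4 => 1
    | Sum.inr i => if i = j then -1 else 0
  let b : Fin 5 ⊕ Fin n → R := fun k => match k with
    | Sum.inl 0 => x
    | Sum.inl 1 => -x
    | Sum.inl 2 => y
    | Sum.inl 3 => -y
    | Sum.inl 4 => (1 + ε) • u
    | Sum.inr _ => 0
  obtain ⟨c, hc⟩ := exists_solution_of_certificates a b (by
    intro l hl hz
    simp only [Fintype.sum_sum_type, Fin.sum_univ_five, a, mul_ite, mul_zero, mul_one,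
      mul_neg, Finset.sum_ite_eq', Finset.mem_univ, if_true] at hz
    simp only [Fintype.sum_sum_type, Fin.sum_univ_five, b, smul_zero, Finset.sum_const_zero,
      add_zero]
    -- With `-(p, q) = ρ (cos φ, sin φ)`, column `j` of the certificate says `ρ cos (φ - tⱼ) ≤ τ`,
    -- hence `ρ ≤ (1 + ε) τ` by the choice of net. The right-hand side is then `ρ (u - (cos φ x +
    -- sin φ y)) + (τ (1 + ε) - ρ) u ≥ 0`.
    set p := l (Sum.inl 0) - l (Sum.inl 1) with hp
    set q := l (Sum.inl 2) - l (Sum.inl 3) with hq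
    set τ := l (Sum.inl 4) with hτ
    obtain ⟨ρ, φ, hρ, h1, h2, hpc, hqs⟩ : ∃ ρ φ : ℝ, 0 ≤ ρ ∧ -Real.pi ≤ φ ∧ φ ≤ Real.pi ∧
        -p = ρ * Real.cos φ ∧ -q = ρ * Real.sin φ := by
      refine ⟨‖(⟨-p, -q⟩ : ℂ)‖, Complex.arg (⟨-p, -q⟩ : ℂ), norm_nonneg _,
        (Complex.neg_pi_lt_arg _).le, Complex.arg_le_pi _, ?_, ?_⟩
      · exact (Complex.norm_mul_cos_arg (⟨-p, -q⟩ : ℂ)).symm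
      · exact (Complex.norm_mul_sin_arg (⟨-p, -q⟩ : ℂ)).symm
    obtain ⟨j, hj⟩ := ht φ h1 h2
    have h3 : ρ * Real.cos (φ - t j) ≤ τ := by
      have := hz j
      have h5 := hl (Sum.inr j)
      rw [Real.cos_sub]
      have h6 : ρ * (Real.cos φ * Real.cos (t j) + Real.sin φ * Real.sin (t j))
        = -p * Real.cos (t j) + -q * Real.sin (t j) := by rw [hpc, hqs]; ring
      rw [h6, hp, hq]
      linarith
    have h4 : ρ ≤ τ * (1 + ε) := by
      have h7 : ρ * (1 - ε / (1 + ε)) ≤ τ := (mul_le_mul_of_nonneg_left hj hρ).trans h3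
      have h8 : 1 - ε / (1 + ε) = (1 + ε)⁻¹ := by field_simp; ring
      rw [h8, ← div_eq_mul_inv, div_le_iff₀ (by positivity)] at h7
      exact h7
    have h5 : 0 ≤ ρ • (u - (Real.cos φ • x + Real.sin φ • y)) :=
      smul_nonneg hρ (sub_nonneg.2 (h φ))
    have h6 : 0 ≤ (τ * (1 + ε) - ρ) • u := smul_nonneg (sub_nonneg.2 h4) hu
    have h7 := add_nonneg h5 h6
    convert h7 using 1
    simp only [smul_sub, smul_add, smul_smul, ← hpc, ← hqs, hp, hq, sub_smul, neg_smul, smul_neg]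
    abel)
  refine ⟨n, t, c, fun j => ?_, le_antisymm ?_ ?_, le_antisymm ?_ ?_, ?_⟩
  · simpa [a, b] using hc (Sum.inr j)
  · have := hc (Sum.inl 1)
    simpa [a, b] using this
  · exact hc (Sum.inl 0)
  · have := hc (Sum.inl 3)
    simpa [a, b] using this
  · exact hc (Sum.inl 2)
  · have := hc (Sum.inl 4)
    simpa [a, b] using this

end VectorLattice

/-! ### Cones in complex vector spaces -/

section Cone

variable {V : Type u} [AddCommGroup V] [Module ℂ V] {C : PointedCone ℝ V}

theorem mem_realSpan_of_mem {x : V} (hx : x ∈ C) : x ∈ realSpan C := Submodule.subset_span hx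

theorem mem_realSpan_iff {x : V} : x ∈ realSpan C ↔ ∃ a ∈ C, ∃ b ∈ C, x = a - b := by
  refine ⟨fun hx => ?_, ?_⟩
  · induction hx using Submodule.span_induction with
    | mem x hx => exact ⟨x, hx, 0, C.zero_mem, (sub_zero x).symm⟩
    | zero => exact ⟨0, C.zero_mem, 0, C.zero_mem, (sub_zero 0).symm⟩
    | add x y _ _ hx hy =>
      obtain ⟨a, ha, b, hb, rfl⟩ := hx
      obtain ⟨c, hc, d, hd, rfl⟩ := hy
      exact ⟨a + c, C.add_mem ha hc, b + d, C.add_mem hb hd, by abel⟩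
    | smul t x _ hx =>
      obtain ⟨a, ha, b, hb, rfl⟩ := hx
      rcases le_total 0 t with ht | ht
      · exact ⟨t • a, C.smul_mem ht ha, t • b, C.smul_mem ht hb, smul_sub _ _ _⟩
      · have ht' := neg_nonneg.2 ht
        exact ⟨(-t) • b, C.smul_mem ht' hb, (-t) • a, C.smul_mem ht' ha, by
          rw [smul_sub, neg_smul, neg_smul]; abel⟩
  · rintro ⟨a, ha, b, hb, rfl⟩
    exact sub_mem (mem_realSpan_of_mem ha) (mem_realSpan_of_mem hb)

/-- `w` dominates the modulus of `z`, that is, `z = x + i y` with `x`, `y` real and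
`x cos t + y sin t ≤ w` for all `t`. -/
def Dominates (C : PointedCone ℝ V) (z w : V) : Prop :=
  ∃ x ∈ realSpan C, ∃ y ∈ realSpan C, z = x + Complex.I • y ∧
    ∀ t : ℝ, w - (Real.cos t • x + Real.sin t • y) ∈ C

theorem IsModulus.dominates {z w : V} (h : IsModulus C z w) : Dominates C z w := by
  obtain ⟨x, hx, y, hy, hz, hs⟩ := h
  exact ⟨x, hx, y, hy, hz, fun t => hs.1 _ ⟨t, rfl⟩⟩

theorem Dominates.of_mem {x : V} (hx : x ∈ C) : Dominates C x x := by
  refine ⟨x, mem_realSpan_of_mem hx, 0, zero_mem _, by simp, fun t => ?_⟩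
  have := C.smul_mem (sub_nonneg.2 (Real.cos_le_one t)) hx
  rw [sub_smul, one_smul] at this
  rwa [smul_zero, add_zero]

theorem Dominates.add {z w z' w' : V} (h : Dominates C z w) (h' : Dominates C z' w') :
    Dominates C (z + z') (w + w') := by
  obtain ⟨x, hx, y, hy, rfl, hs⟩ := h
  obtain ⟨x', hx', y', hy', rfl, hs'⟩ := h'
  refine ⟨x + x', add_mem hx hx', y + y', add_mem hy hy', by rw [smul_add]; abel, fun t => ?_⟩
  convert C.add_mem (hs t) (hs' t) using 1
  simp only [smul_add]; abel

theorem Dominates.add_mem {z w c : V} (h : Dominates C z w) (hc : c ∈ C) :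
    Dominates C z (w + c) := by
  obtain ⟨x, hx, y, hy, rfl, hs⟩ := h
  refine ⟨x, hx, y, hy, rfl, fun t => ?_⟩
  rw [add_sub_right_comm]
  exact C.add_mem (hs t) hc

theorem Dominates.mono {z w w' : V} (h : Dominates C z w) (hc : w' - w ∈ C) :
    Dominates C z w' := by
  simpa using h.add_mem hc

theorem Dominates.sum {ι : Type*} (s : Finset ι) {z w : ι → V}
    (h : ∀ i ∈ s, Dominates C (z i) (w i)) : Dominates C (∑ i ∈ s, z i) (∑ i ∈ s, w i) := by
  classical
  induction s using Finset.induction_on with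
  | empty => simpa using Dominates.of_mem C.zero_mem
  | insert a s ha ih =>
    rw [Finset.sum_insert ha, Finset.sum_insert ha]
    exact (h a (Finset.mem_insert_self _ _)).add
      (ih fun i hi => h i (Finset.mem_insert_of_mem hi))

theorem Dominates.real_smul {z w : V} (h : Dominates C z w) {t : ℝ} (ht : 0 ≤ t) :
    Dominates C (t • z) (t • w) := by
  obtain ⟨x, hx, y, hy, rfl, hs⟩ := h
  refine ⟨t • x, Submodule.smul_mem _ _ hx, t • y, Submodule.smul_mem _ _ hy, ?_, fun s => ?_⟩
  · rw [smul_add, smul_comm]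
  · convert C.smul_mem ht (hs s) using 1
    rw [smul_sub, smul_add, smul_comm t, smul_comm t]

theorem exp_smul_add (φ : ℝ) (x y : V) : Complex.exp (φ * Complex.I) • (x + Complex.I • y) =
    (Real.cos φ • x - Real.sin φ • y) + Complex.I • (Real.sin φ • x + Real.cos φ • y) := by
  have hr : ∀ (t : ℝ) (v : V), t • v = (t : ℂ) • v := fun _ _ => rfl
  rw [Complex.exp_mul_I]
  simp only [hr, smul_add, smul_smul, Complex.ofReal_cos, Complex.ofReal_sin, add_smul, add_mul]
  rw [mul_assoc (Complex.sin φ), Complex.I_mul_I, mul_neg_one, neg_smul,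
    mul_comm Complex.I (Complex.sin φ), mul_comm Complex.I (Complex.cos φ)]
  abel

/-- Multiplication by `exp (iφ)` only shifts the parameter of the family `x cos t + y sin t`. -/
theorem Dominates.rotate {z w : V} (h : Dominates C z w) (φ : ℝ) :
    Dominates C (Complex.exp (φ * Complex.I) • z) w := by
  obtain ⟨x, hx, y, hy, rfl, hs⟩ := h
  refine ⟨_, sub_mem (Submodule.smul_mem _ _ hx) (Submodule.smul_mem _ _ hy), _,
    AddMemClass.add_mem (Submodule.smul_mem _ _ hx) (Submodule.smul_mem _ _ hy), exp_smul_add φ x y,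
    fun t => ?_⟩
  convert hs (t - φ) using 2
  rw [Real.cos_sub, Real.sin_sub]
  simp only [smul_sub, smul_add, smul_smul, add_smul, sub_smul]
  abel

theorem Dominates.smul {z w : V} (h : Dominates C z w) (c : ℂ) :
    Dominates C (c • z) (‖c‖ • w) := by
  have h1 := (h.rotate c.arg).real_smul (norm_nonneg c)
  have h2 : ‖c‖ • Complex.exp (c.arg * Complex.I) • z = c • z := by
    change ((‖c‖ : ℝ) : ℂ) • Complex.exp (c.arg * Complex.I) • z = _
    rw [smul_smul, Complex.norm_mul_exp_arg_mul_I]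
  rwa [h2] at h1

/-- Uniqueness of real and imaginary parts. -/
theorem eq_and_eq_of_add_I_smul
    (huniq : ∀ x ∈ realSpan C, Complex.I • x ∈ realSpan C → x = 0) {x y x' y' : V}
    (hx : x ∈ realSpan C) (hy : y ∈ realSpan C) (hx' : x' ∈ realSpan C) (hy' : y' ∈ realSpan C)
    (h : x + Complex.I • y = x' + Complex.I • y') : x = x' ∧ y = y' := by
  have h1 : Complex.I • (y - y') = x' - x := by
    rw [smul_sub, sub_eq_sub_iff_add_eq_add, add_comm, h]
  have h2 : y - y' = 0 := huniq _ (sub_mem hy hy') (h1 ▸ sub_mem hx' hx)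
  rw [h2, smul_zero] at h1
  exact ⟨(sub_eq_zero.1 h1.symm).symm, sub_eq_zero.1 h2⟩

/-- The modulus is the least dominating element. `huniq` is needed because each predicate comes with
its own real and imaginary parts. -/
theorem IsModulus.sub_mem {z w v : V} (h : IsModulus C z w) (hv : Dominates C z v)
    (huniq : ∀ x ∈ realSpan C, Complex.I • x ∈ realSpan C → x = 0) : v - w ∈ C := by
  obtain ⟨x, hx, y, hy, hz, hs⟩ := h
  obtain ⟨x', hx', y', hy', hz', hs'⟩ := hv
  obtain ⟨rfl, rfl⟩ := eq_and_eq_of_add_I_smul huniq hx hy hx' hy' (hz ▸ hz')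
  refine hs.2 v ?_
  rintro _ ⟨t, rfl⟩
  exact hs' t

/-- Average the inequalities at `t = 0` and `t = π`. -/
theorem Dominates.mem {z w : V} (h : Dominates C z w) : w ∈ C := by
  obtain ⟨x, hx, y, hy, hz, hs⟩ := h
  have h1 := C.add_mem (hs 0) (hs Real.pi)
  simp only [Real.cos_zero, Real.sin_zero, Real.cos_pi, Real.sin_pi, one_smul, zero_smul, add_zero,
    neg_smul, sub_neg_eq_add, sub_add_add_cancel] at h1
  have h2 := C.smul_mem (show (0 : ℝ) ≤ 1 / 2 by norm_num) h1
  rw [← two_smul ℝ w, smul_smul] at h2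
  simpa using h2

theorem IsModulus.eq {z w w' : V} (h : IsModulus C z w) (h' : IsModulus C z w')
    (huniq : ∀ x ∈ realSpan C, Complex.I • x ∈ realSpan C → x = 0)
    (hsal : ∀ x ∈ C, -x ∈ C → x = 0) : w = w' := by
  have h1 := h.sub_mem h'.dominates huniq
  have h2 := h'.sub_mem h.dominates huniq
  exact (sub_eq_zero.1 (hsal _ h1 (by rwa [neg_sub]))).symm

theorem IsModulus.of_mem {x : V} (hx : x ∈ C) : IsModulus C x x := by
  refine ⟨x, mem_realSpan_of_mem hx, 0, zero_mem _, by simp, ?_, fun v hv => ?_⟩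
  · rintro _ ⟨t, rfl⟩
    have := C.smul_mem (sub_nonneg.2 (Real.cos_le_one t)) hx
    rw [sub_smul, one_smul] at this
    simpa only [smul_zero, add_zero] using this
  · simpa using hv _ ⟨0, rfl⟩

end Cone

/-! ### Complex Banach lattices -/

/-- `E` is the complexification of the real Banach lattice `R` through `ι`. -/
structure IsComplexification (E : ConeSpace.{u}) {R : Type u} [RealBanachLattice R]
    (ι : R →ₗ[ℝ] E) : Prop where
  existsUnique : ∀ z : E, ∃! p : R × R, z = ι p.1 + Complex.I • ι p.2
  mem_pos : ∀ z : E, z ∈ E.pos ↔ ∃ x : R, 0 ≤ x ∧ ι x = z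
  norm : ∀ x y : R, ∃ r : R,
      IsLUB (Set.range fun θ : ℝ => Real.cos θ • x + Real.sin θ • y) r ∧
        ‖ι x + Complex.I • ι y‖ = ‖r‖

namespace IsComplexification

variable {E : ConeSpace.{u}} {R : Type u} [RealBanachLattice R] {ι : R →ₗ[ℝ] E}

theorem exists_re_im (h : IsComplexification E ι) (z : E) :
    ∃ x y : R, z = ι x + Complex.I • ι y := by
  obtain ⟨p, hp, -⟩ := h.existsUnique z
  exact ⟨p.1, p.2, hp⟩

theorem ext_iff (h : IsComplexification E ι) {x y x' y' : R}
    (he : ι x + Complex.I • ι y = ι x' + Complex.I • ι y') : x = x' ∧ y = y' := by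
  have := (h.existsUnique (ι x + Complex.I • ι y)).unique (y₁ := (x, y)) (y₂ := (x', y')) rfl he
  exact ⟨congrArg Prod.fst this, congrArg Prod.snd this⟩

theorem injective (h : IsComplexification E ι) {x x' : R} (he : ι x = ι x') : x = x' :=
  (h.ext_iff (x := x) (y := 0) (x' := x') (y' := 0) (by rw [he])).1

theorem map_mem (h : IsComplexification E ι) {x : R} : ι x ∈ E.pos ↔ 0 ≤ x := by
  rw [h.mem_pos]
  exact ⟨fun ⟨y, hy, he⟩ => h.injective he ▸ hy, fun hx => ⟨x, hx, rfl⟩⟩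

theorem map_sub_mem (h : IsComplexification E ι) {x y : R} : ι x - ι y ∈ E.pos ↔ y ≤ x := by
  rw [← map_sub, h.map_mem, sub_nonneg]

theorem mem_realSpan (h : IsComplexification E ι) {z : E} :
    z ∈ realSpan E.pos ↔ ∃ x, ι x = z := by
  rw [mem_realSpan_iff]
  constructor
  · rintro ⟨a, ha, b, hb, rfl⟩
    obtain ⟨x, -, rfl⟩ := (h.mem_pos a).1 ha
    obtain ⟨y, -, rfl⟩ := (h.mem_pos b).1 hb
    exact ⟨x - y, map_sub _ _ _⟩
  · rintro ⟨x, rfl⟩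
    exact ⟨ι x⁺, h.map_mem.2 (posPart_nonneg x), ι x⁻, h.map_mem.2 (negPart_nonneg x), by
      rw [← map_sub, posPart_sub_negPart]⟩

theorem eq_zero_of_I_smul (h : IsComplexification E ι) (x : E) (hx : x ∈ realSpan E.pos)
    (hx' : Complex.I • x ∈ realSpan E.pos) : x = 0 := by
  obtain ⟨a, rfl⟩ := h.mem_realSpan.1 hx
  obtain ⟨b, hb⟩ := h.mem_realSpan.1 hx'
  have := (h.ext_iff (x := b) (y := 0) (x' := 0) (y' := a) (by simp [hb])).2
  rw [← this, map_zero]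

theorem salient (h : IsComplexification E ι) (x : E) (hx : x ∈ E.pos) (hx' : -x ∈ E.pos) :
    x = 0 := by
  obtain ⟨a, ha, rfl⟩ := (h.mem_pos x).1 hx
  rw [← map_neg, h.map_mem] at hx'
  rw [le_antisymm (neg_nonneg.1 hx') ha, map_zero]

theorem dominates_iff (h : IsComplexification E ι) {x y u : R} :
    Dominates E.pos (ι x + Complex.I • ι y) (ι u) ↔
      ∀ t : ℝ, Real.cos t • x + Real.sin t • y ≤ u := by
  constructor
  · rintro ⟨x', hx, y', hy, he, hs⟩ t
    obtain ⟨x', rfl⟩ := h.mem_realSpan.1 hx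
    obtain ⟨y', rfl⟩ := h.mem_realSpan.1 hy
    obtain ⟨rfl, rfl⟩ := h.ext_iff he
    have := hs t
    rwa [← map_smul, ← map_smul, ← map_add, h.map_sub_mem] at this
  · intro hs
    refine ⟨_, h.mem_realSpan.2 ⟨x, rfl⟩, _, h.mem_realSpan.2 ⟨y, rfl⟩, rfl, fun t => ?_⟩
    rw [← map_smul, ← map_smul, ← map_add, h.map_sub_mem]
    exact hs t

theorem exists_isModulus (h : IsComplexification E ι) (x y : R) :
    ∃ r : R, 0 ≤ r ∧ IsModulus E.pos (ι x + Complex.I • ι y) (ι r) ∧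
      ‖ι x + Complex.I • ι y‖ = ‖r‖ := by
  obtain ⟨r, hr, hn⟩ := h.norm x y
  have hd : Dominates E.pos (ι x + Complex.I • ι y) (ι r) :=
    h.dominates_iff.2 fun t => hr.1 ⟨t, rfl⟩
  refine ⟨r, h.map_mem.1 hd.mem, ⟨_, h.mem_realSpan.2 ⟨x, rfl⟩, _, h.mem_realSpan.2 ⟨y, rfl⟩, rfl,
    ?_, ?_⟩, hn⟩
  · rintro _ ⟨t, rfl⟩
    simp only [← map_smul, ← map_add]
    exact h.map_sub_mem.2 (hr.1 ⟨t, rfl⟩)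
  · intro v hv
    -- An upper bound of real elements differs from one of them by a positive element, so it is
    -- itself real.
    obtain ⟨u, rfl⟩ : ∃ u, ι u = v := by
      have := hv _ ⟨0, rfl⟩
      obtain ⟨a, -, ha⟩ := (h.mem_pos _).1 this
      simp only [← map_smul, ← map_add] at ha
      exact ⟨a + (Real.cos 0 • x + Real.sin 0 • y), by rw [map_add, ha, sub_add_cancel]⟩
    rw [h.map_sub_mem]
    refine hr.2 ?_
    rintro _ ⟨t, rfl⟩
    have := hv _ ⟨t, rfl⟩
    simp only [← map_smul, ← map_add] at this
    exact h.map_sub_mem.1 this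

theorem norm_map_of_nonneg (h : IsComplexification E ι) {x : R} (hx : 0 ≤ x) : ‖ι x‖ = ‖x‖ := by
  obtain ⟨r, hr, hm, hn⟩ := h.exists_isModulus x 0
  simp only [map_zero, smul_zero, add_zero] at hm hn
  have := hm.eq (IsModulus.of_mem (h.map_mem.2 hx)) h.eq_zero_of_I_smul h.salient
  rw [hn, h.injective this]

theorem norm_le_of_dominates (h : IsComplexification E ι) {z w : E} (hd : Dominates E.pos z w) :
    ‖z‖ ≤ ‖w‖ := by
  obtain ⟨x, y, rfl⟩ := h.exists_re_im z
  obtain ⟨u, hu, rfl⟩ := (h.mem_pos w).1 hd.mem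
  obtain ⟨r, hr, hm, hn⟩ := h.exists_isModulus x y
  rw [hn, h.norm_map_of_nonneg hu]
  refine norm_le_norm_of_abs_le_abs ?_
  rw [abs_of_nonneg hr, abs_of_nonneg hu]
  exact h.map_sub_mem.1 (hm.sub_mem hd h.eq_zero_of_I_smul)

theorem norm_re_le (h : IsComplexification E ι) (x y : R) : ‖x‖ ≤ ‖ι x + Complex.I • ι y‖ := by
  obtain ⟨r, hr, hm, hn⟩ := h.exists_isModulus x y
  rw [hn]
  have hd := h.dominates_iff.1 hm.dominates
  refine norm_le_norm_of_abs_le_abs ?_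
  rw [abs_of_nonneg hr]
  exact abs_le'.2 ⟨by simpa using hd 0, by simpa using hd Real.pi⟩

theorem norm_im_le (h : IsComplexification E ι) (x y : R) : ‖y‖ ≤ ‖ι x + Complex.I • ι y‖ := by
  obtain ⟨r, hr, hm, hn⟩ := h.exists_isModulus x y
  rw [hn]
  have hd := h.dominates_iff.1 hm.dominates
  refine norm_le_norm_of_abs_le_abs ?_
  rw [abs_of_nonneg hr]
  exact abs_le'.2 ⟨by simpa using hd (Real.pi / 2), by simpa using hd (-(Real.pi / 2))⟩

theorem core (h : IsComplexification E ι) : NormedSpace.Core ℂ E where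
  norm_nonneg z := by
    obtain ⟨x, y, rfl⟩ := h.exists_re_im z
    exact (norm_nonneg x).trans (h.norm_re_le x y)
  norm_triangle z w := by
    obtain ⟨x, y, rfl⟩ := h.exists_re_im z
    obtain ⟨x', y', rfl⟩ := h.exists_re_im w
    obtain ⟨r, hr, hm, hn⟩ := h.exists_isModulus x y
    obtain ⟨r', hr', hm', hn'⟩ := h.exists_isModulus x' y'
    rw [hn, hn']
    refine (h.norm_le_of_dominates (hm.dominates.add hm'.dominates)).trans ?_
    rw [← map_add, h.norm_map_of_nonneg (add_nonneg hr hr')]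
    exact norm_add_le _ _
  norm_smul c z := by
    -- Domination gives one inequality; applying it to `c⁻¹` gives the other.
    have key : ∀ (c : ℂ) (z : E), ‖c • z‖ ≤ ‖c‖ * ‖z‖ := by
      intro c z
      obtain ⟨x, y, rfl⟩ := h.exists_re_im z
      obtain ⟨r, hr, hm, hn⟩ := h.exists_isModulus x y
      refine (h.norm_le_of_dominates (hm.dominates.smul c)).trans ?_
      rw [hn, ← map_smul, h.norm_map_of_nonneg (smul_nonneg (norm_nonneg c) hr), norm_smul,
        norm_norm]
    refine le_antisymm (key c z) ?_
    rcases eq_or_ne c 0 with rfl | hc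
    · rw [norm_zero, zero_mul, zero_smul]
      obtain ⟨x, y, hz⟩ := h.exists_re_im (0 : E)
      rw [hz]
      exact (norm_nonneg x).trans (h.norm_re_le x y)
    · have := key c⁻¹ (c • z)
      rw [smul_smul, inv_mul_cancel₀ hc, one_smul, norm_inv] at this
      rwa [← le_inv_mul_iff₀ (norm_pos_iff.2 hc)]
  norm_eq_zero_iff z := by
    constructor
    · intro hz
      obtain ⟨x, y, rfl⟩ := h.exists_re_im z
      have h1 := h.norm_re_le x y
      have h2 := h.norm_im_le x y
      rw [hz] at h1 h2
      rw [norm_le_zero_iff.1 h1, norm_le_zero_iff.1 h2]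
      simp
    · rintro rfl
      simpa using h.norm_map_of_nonneg (le_refl (0 : R))

theorem isBanach (h : IsComplexification E ι) : IsBanach E where
  core := h.core
  complete := by
    intro s hs
    choose x y hxy using fun n => h.exists_re_im (s n)
    have hsub : ∀ (i : ℕ) (a b : R), s i - (ι a + Complex.I • ι b)
        = ι (x i - a) + Complex.I • ι (y i - b) := by
      intro i a b
      rw [hxy i, map_sub, map_sub, smul_sub]; abel
    have hx : CauchySeq x := Metric.cauchySeq_iff.2 fun ε hε => by
      obtain ⟨N, hN⟩ := hs ε hε
      refine ⟨N, fun i hi j hj => ?_⟩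
      have := hN i hi j hj
      rw [hxy j, hsub] at this
      rw [dist_eq_norm]
      exact (h.norm_re_le _ _).trans_lt this
    have hy : CauchySeq y := Metric.cauchySeq_iff.2 fun ε hε => by
      obtain ⟨N, hN⟩ := hs ε hε
      refine ⟨N, fun i hi j hj => ?_⟩
      have := hN i hi j hj
      rw [hxy j, hsub] at this
      rw [dist_eq_norm]
      exact (h.norm_im_le _ _).trans_lt this
    obtain ⟨a, ha⟩ := cauchySeq_tendsto_of_complete hx
    obtain ⟨b, hb⟩ := cauchySeq_tendsto_of_complete hy
    refine ⟨ι a + Complex.I • ι b, fun ε hε => ?_⟩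
    obtain ⟨N₁, h1⟩ := Metric.tendsto_atTop.1 ha (ε / 2) (half_pos hε)
    obtain ⟨N₂, h2⟩ := Metric.tendsto_atTop.1 hb (ε / 2) (half_pos hε)
    have hn : ∀ r : R, ‖ι r‖ ≤ ‖r‖ := fun r => by
      rw [← norm_abs_eq_norm r, ← h.norm_map_of_nonneg (abs_nonneg r)]
      have hd : Dominates E.pos (ι r + Complex.I • ι 0) (ι |r|) := h.dominates_iff.2 fun t => by
        rw [smul_zero, add_zero]
        have h3 := Real.neg_one_le_cos t
        have h4 := Real.cos_le_one t
        have h5 : Real.cos t • r ≤ |Real.cos t| • |r| := by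
          rcases le_total 0 (Real.cos t) with h6 | h6
          · rw [abs_of_nonneg h6]; exact smul_le_smul_of_nonneg_left (le_abs_self r) h6
          · rw [abs_of_nonpos h6, ← neg_smul_neg]
            exact smul_le_smul_of_nonneg_left (neg_le_abs r) (neg_nonneg.2 h6)
        refine h5.trans ?_
        have h6 := smul_nonneg (sub_nonneg.2 (Real.abs_cos_le_one t)) (abs_nonneg r)
        rwa [sub_smul, one_smul, sub_nonneg] at h6
      have := h.norm_le_of_dominates hd
      rwa [map_zero, smul_zero, add_zero] at this
    refine ⟨max N₁ N₂, fun i hi => ?_⟩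
    rw [hsub]
    have h3 := h1 i (le_of_max_le_left hi)
    have h4 := h2 i (le_of_max_le_right hi)
    rw [dist_eq_norm] at h3 h4
    have h5 : ‖Complex.I • ι (y i - b)‖ = ‖ι (y i - b)‖ := by
      rw [h.core.norm_smul, Complex.norm_I, one_mul]
    have := h.core.norm_triangle (ι (x i - a)) (Complex.I • ι (y i - b))
    rw [h5] at this
    linarith [hn (x i - a), hn (y i - b)]

/-- The positive cone is norm closed: in the limit the imaginary part vanishes and the real part is
a limit of nonnegative elements. -/
theorem mem_pos_of_approx (h : IsComplexification E ι) {v : E}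
    (hv : ∀ ε : ℝ, 0 < ε → ∃ c ∈ E.pos, ‖v - c‖ < ε) : v ∈ E.pos := by
  obtain ⟨x, y, rfl⟩ := h.exists_re_im v
  have h1 : ∀ ε : ℝ, 0 < ε → ‖y‖ < ε ∧ ∃ r : R, 0 ≤ r ∧ ‖x - r‖ < ε := by
    intro ε hε
    obtain ⟨c, hc, hn⟩ := hv ε hε
    obtain ⟨r, hr, rfl⟩ := (h.mem_pos c).1 hc
    rw [add_sub_right_comm, ← map_sub] at hn
    exact ⟨(h.norm_im_le _ _).trans_lt hn, r, hr, (h.norm_re_le _ _).trans_lt hn⟩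
  have hy : y = 0 := by
    rw [← norm_le_zero_iff]
    exact le_of_forall_pos_lt_add fun ε hε => by simpa using (h1 ε hε).1
  rw [hy, map_zero, smul_zero, add_zero, h.map_mem]
  have : x ∈ closure {r : R | 0 ≤ r} := Metric.mem_closure_iff.2 fun ε hε => by
    obtain ⟨-, r, hr, hn⟩ := h1 ε hε
    exact ⟨r, hr, by rwa [dist_eq_norm]⟩
  rwa [isClosed_nonneg.closure_eq] at this

end IsComplexification

namespace IsComplexBanachLattice

variable {E : ConeSpace.{u}}

theorem exists_isComplexification (hE : IsComplexBanachLattice E) :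
    ∃ (R : Type u) (_ : RealBanachLattice R) (ι : R →ₗ[ℝ] E), IsComplexification E ι := by
  obtain ⟨R, i, ι, h1, h2, h3⟩ := hE
  exact ⟨R, i, ι, h1, h2, h3⟩

theorem isBanach (hE : IsComplexBanachLattice E) : IsBanach E := by
  obtain ⟨R, _, ι, h⟩ := hE.exists_isComplexification
  exact h.isBanach

theorem salient (hE : IsComplexBanachLattice E) (x : E) (hx : x ∈ E.pos) (hx' : -x ∈ E.pos) :
    x = 0 := by
  obtain ⟨R, _, ι, h⟩ := hE.exists_isComplexification
  exact h.salient x hx hx'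

theorem eq_zero_of_I_smul (hE : IsComplexBanachLattice E) (x : E) (hx : x ∈ realSpan E.pos)
    (hx' : Complex.I • x ∈ realSpan E.pos) : x = 0 := by
  obtain ⟨R, _, ι, h⟩ := hE.exists_isComplexification
  exact h.eq_zero_of_I_smul x hx hx'

theorem exists_re_im (hE : IsComplexBanachLattice E) (z : E) :
    ∃ x ∈ realSpan E.pos, ∃ y ∈ realSpan E.pos, z = x + Complex.I • y := by
  obtain ⟨R, _, ι, h⟩ := hE.exists_isComplexification
  obtain ⟨x, y, rfl⟩ := h.exists_re_im z
  exact ⟨_, h.mem_realSpan.2 ⟨x, rfl⟩, _, h.mem_realSpan.2 ⟨y, rfl⟩, rfl⟩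

theorem norm_le_of_dominates (hE : IsComplexBanachLattice E) {z w : E}
    (hd : Dominates E.pos z w) : ‖z‖ ≤ ‖w‖ := by
  obtain ⟨R, _, ι, h⟩ := hE.exists_isComplexification
  exact h.norm_le_of_dominates hd

theorem norm_le_norm (hE : IsComplexBanachLattice E) {x y : E} (hx : x ∈ E.pos)
    (hxy : y - x ∈ E.pos) : ‖x‖ ≤ ‖y‖ :=
  hE.norm_le_of_dominates ((Dominates.of_mem hx).mono hxy)

theorem exists_isModulus (hE : IsComplexBanachLattice E) (z : E) :
    ∃ w ∈ E.pos, IsModulus E.pos z w ∧ ‖w‖ = ‖z‖ := by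
  obtain ⟨R, _, ι, h⟩ := hE.exists_isComplexification
  obtain ⟨x, y, rfl⟩ := h.exists_re_im z
  obtain ⟨r, hr, hm, hn⟩ := h.exists_isModulus x y
  exact ⟨ι r, h.map_mem.2 hr, hm, by rw [hn, h.norm_map_of_nonneg hr]⟩

theorem mem_pos_of_approx (hE : IsComplexBanachLattice E) {v : E}
    (hv : ∀ ε : ℝ, 0 < ε → ∃ c ∈ E.pos, ‖v - c‖ < ε) : v ∈ E.pos := by
  obtain ⟨R, _, ι, h⟩ := hE.exists_isComplexification
  exact h.mem_pos_of_approx hv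

theorem span_pos (hE : IsComplexBanachLattice E) :
    Submodule.span ℂ (E.pos : Set E) = ⊤ := by
  refine eq_top_iff.2 fun z _ => ?_
  obtain ⟨x, hx, y, hy, rfl⟩ := hE.exists_re_im z
  have key : ∀ x ∈ realSpan E.pos, x ∈ Submodule.span ℂ (E.pos : Set E) := by
    intro x hx
    obtain ⟨a, ha, b, hb, rfl⟩ := mem_realSpan_iff.1 hx
    exact sub_mem (Submodule.subset_span ha) (Submodule.subset_span hb)
  exact add_mem (key x hx) (Submodule.smul_mem _ _ (key y hy))

theorem riesz_decomposition (hE : IsComplexBanachLattice E) {x y a b : E} (hx : x ∈ E.pos)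
    (hy : y ∈ E.pos) (ha : a ∈ E.pos) (hb : b ∈ E.pos) (he : x + y = a + b) :
    ∃ p ∈ E.pos, ∃ q ∈ E.pos, ∃ r ∈ E.pos, ∃ s ∈ E.pos,
      x = p + q ∧ y = r + s ∧ a = p + r ∧ b = q + s := by
  obtain ⟨R, _, ι, h⟩ := hE.exists_isComplexification
  obtain ⟨x, hx0, rfl⟩ := (h.mem_pos _).1 hx
  obtain ⟨y, hy0, rfl⟩ := (h.mem_pos _).1 hy
  obtain ⟨a, ha0, rfl⟩ := (h.mem_pos _).1 ha
  obtain ⟨b, hb0, rfl⟩ := (h.mem_pos _).1 hb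
  rw [← map_add, ← map_add] at he
  obtain ⟨p, q, r, s, hp, hq, hr, hs, rfl, rfl, rfl, rfl⟩ :=
    _root_.riesz_decomposition hx0 hy0 ha0 hb0 (h.injective he)
  exact ⟨ι p, h.map_mem.2 hp, ι q, h.map_mem.2 hq, ι r, h.map_mem.2 hr, ι s, h.map_mem.2 hs,
    map_add _ _ _, map_add _ _ _, map_add _ _ _, map_add _ _ _⟩

theorem exists_polar_decomposition (hE : IsComplexBanachLattice E) {z u : E}
    (hd : Dominates E.pos z u) {ε : ℝ} (hε : 0 < ε) :
    ∃ (n : ℕ) (t : Fin n → ℝ) (c : Fin n → E), (∀ j, c j ∈ E.pos) ∧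
      z = ∑ j, Complex.exp (t j * Complex.I) • c j ∧ (1 + ε) • u - ∑ j, c j ∈ E.pos := by
  obtain ⟨R, _, ι, h⟩ := hE.exists_isComplexification
  obtain ⟨x, y, rfl⟩ := h.exists_re_im z
  obtain ⟨u, hu, rfl⟩ := (h.mem_pos _).1 hd.mem
  obtain ⟨n, t, c, hc, hx, hy, hs⟩ := _root_.exists_polar_decomposition (h.dominates_iff.1 hd) hε
  refine ⟨n, t, fun j => ι (c j), fun j => h.map_mem.2 (hc j), ?_, ?_⟩
  · rw [hx, hy, map_sum, map_sum, Finset.smul_sum, ← Finset.sum_add_distrib]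
    refine Finset.sum_congr rfl fun j _ => ?_
    rw [map_smul, map_smul, Complex.exp_mul_I, add_smul, mul_comm (Complex.sin _), mul_smul,
      ← Complex.ofReal_cos, ← Complex.ofReal_sin]
    rfl
  · rw [← map_smul, ← map_sum, h.map_sub_mem]
    exact hs

end IsComplexBanachLattice

/-! ### The modulus inequality for multilinear maps -/

/-- Closedness of the cone lets `δ → 0`; this removes the factor lost in the approximate polar
decomposition. -/
theorem Dominates.of_forall_add_smul {F : ConeSpace.{u}} (hF : IsComplexBanachLattice F) {z w : F}
    (h : ∀ δ : ℝ, 0 < δ → Dominates F.pos z ((1 + δ) • w)) : Dominates F.pos z w := by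
  obtain ⟨x, hx, y, hy, hz, -⟩ := h 1 one_pos
  refine ⟨x, hx, y, hy, hz, fun t => hF.mem_pos_of_approx fun ε hε => ?_⟩
  have hw : 0 ≤ ‖w‖ := hF.isBanach.core.norm_nonneg w
  set δ := ε / (2 * (‖w‖ + 1)) with hδ
  have hδ0 : 0 < δ := by positivity
  obtain ⟨x', hx', y', hy', hz', hs⟩ := h δ hδ0
  obtain ⟨rfl, rfl⟩ := eq_and_eq_of_add_I_smul hF.eq_zero_of_I_smul hx hy hx' hy' (hz ▸ hz')
  refine ⟨_, hs t, ?_⟩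
  have h1 : w - (Real.cos t • x + Real.sin t • y) -
      ((1 + δ) • w - (Real.cos t • x + Real.sin t • y)) = ((-δ : ℝ) : ℂ) • w := by
    change _ = (-δ) • w
    rw [add_smul, one_smul, neg_smul]; abel
  rw [h1, hF.isBanach.core.norm_smul, Complex.norm_real, norm_neg, Real.norm_of_nonneg hδ0.le, hδ,
    div_mul_eq_mul_div, div_lt_iff₀ (by positivity)]
  nlinarith

theorem MultilinearMap.map_real_smul_univ {ι V W : Type*} [Fintype ι] [AddCommGroup V]
    [Module ℂ V] [AddCommGroup W] [Module ℂ W] (f : MultilinearMap ℂ (fun _ : ι => V) W)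
    (c : ι → ℝ) (x : ι → V) : f (fun i => c i • x i) = (∏ i, c i) • f x := by
  change f (fun i => ((c i : ℝ) : ℂ) • x i) = ((∏ i, c i : ℝ) : ℂ) • f x
  rw [f.map_smul_univ (fun i => ((c i : ℝ) : ℂ)), Complex.ofReal_prod]

/-- The cone of multilinear maps which are positive at positive arguments. -/
def positiveMaps (ι : Type) (E : ConeSpace.{u}) {W : Type u} [AddCommGroup W] [Module ℂ W]
    (C : PointedCone ℝ W) : PointedCone ℝ (MultilinearMap ℂ (fun _ : ι => E) W) where
  carrier := {A | ∀ x : ι → E, (∀ i, x i ∈ E.pos) → A x ∈ C}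
  zero_mem' := fun _ _ => C.zero_mem
  add_mem' := fun hA hB x hx => C.add_mem (hA x hx) (hB x hx)
  smul_mem' := fun c _ hA x hx => C.smul_mem c.2 (hA x hx)

/-- Expand `B (x + (y - x))` over subsets of the indices: one term is `B x`, and all the others have
positive arguments. -/
theorem map_sub_map_mem_of_mem_positiveMaps {ι : Type} [Fintype ι] {E : ConeSpace.{u}} {W : Type u}
    [AddCommGroup W] [Module ℂ W] {C : PointedCone ℝ W}
    {B : MultilinearMap ℂ (fun _ : ι => E) W} (hB : B ∈ positiveMaps ι E C) {x y : ι → E}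
    (hx : ∀ i, x i ∈ E.pos) (hxy : ∀ i, y i - x i ∈ E.pos) : B y - B x ∈ C := by
  classical
  have h1 := B.map_add_univ x (y - x)
  rw [add_sub_cancel, ← Finset.add_sum_erase _ _ (Finset.mem_univ Finset.univ),
    Finset.piecewise_univ] at h1
  rw [h1, add_sub_cancel_left]
  refine sum_mem fun s _ => hB _ fun i => ?_
  by_cases hi : i ∈ s
  · simpa [Finset.piecewise_eq_of_mem _ _ _ hi] using hx i
  · simpa [Finset.piecewise_eq_of_notMem _ _ _ hi] using hxy i

/-- If `|A| ≤ B` then `|A (z₁, …, zₘ)| ≤ B (|z₁|, …, |zₘ|)`. -/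
theorem Dominates.map_multilinear {ι : Type} [Fintype ι] {E F : ConeSpace.{u}}
    (hE : IsComplexBanachLattice E) (hF : IsComplexBanachLattice F)
    {A B : MultilinearMap ℂ (fun _ : ι => E) F}
    (hAB : ∀ x : ι → E, (∀ i, x i ∈ E.pos) → Dominates F.pos (A x) (B x)) {z u : ι → E}
    (h : ∀ i, Dominates E.pos (z i) (u i)) : Dominates F.pos (A z) (B u) := by
  classical
  have hB : B ∈ positiveMaps ι E F.pos := fun x hx => (hAB x hx).mem
  have hBu : B u ∈ F.pos := hB _ fun i => (h i).mem
  refine Dominates.of_forall_add_smul hF fun δ hδ => ?_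
  obtain ⟨ε, hε, hle⟩ : ∃ ε : ℝ, 0 < ε ∧ (1 + ε) ^ Fintype.card ι ≤ 1 + δ := by
    have hc : Filter.Tendsto (fun ε : ℝ => (1 + ε) ^ Fintype.card ι) (nhdsWithin 0 (Set.Ioi 0))
        (nhds 1) := by
      have : Continuous fun ε : ℝ => (1 + ε) ^ Fintype.card ι := by fun_prop
      simpa using (this.tendsto 0).mono_left nhdsWithin_le_nhds
    have h1 := hc.eventually (ge_mem_nhds (show (1 : ℝ) < 1 + δ by linarith))
    obtain ⟨ε, h2, h3⟩ := (h1.and self_mem_nhdsWithin).exists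
    exact ⟨ε, h3, h2⟩
  choose n t c hc hz hs using fun i => hE.exists_polar_decomposition (h i) hε
  have h1 : A z = ∑ r : (∀ i, Fin (n i)), (∏ i, Complex.exp (t i (r i) * Complex.I)) •
      A (fun i => c i (r i)) := by
    rw [show z = fun i => ∑ j, Complex.exp (t i j * Complex.I) • c i j from funext hz,
      A.map_sum (fun i j => Complex.exp (t i j * Complex.I) • c i j)]
    exact Finset.sum_congr rfl fun r _ => A.map_smul_univ _ _
  have h2 : B (fun i => ∑ j, c i j) = ∑ r : (∀ i, Fin (n i)), B (fun i => c i (r i)) :=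
    B.map_sum c
  -- Term by term: the phases have modulus `1`, and the remaining arguments are positive, where
  -- `hAB` applies.
  have h3 : Dominates F.pos (A z) (B fun i => ∑ j, c i j) := by
    rw [h1, h2]
    refine Dominates.sum _ fun r _ => ?_
    have := (hAB (fun i => c i (r i)) fun i => hc i _).smul
      (∏ i, Complex.exp (t i (r i) * Complex.I))
    simpa [norm_prod, Complex.norm_exp_ofReal_mul_I] using this
  have h4 := map_sub_map_mem_of_mem_positiveMaps hB
    (fun i => sum_mem fun j _ => hc i j) hs
  refine (h3.mono h4).mono ?_
  rw [B.map_real_smul_univ (fun _ => 1 + ε), Finset.prod_const, Finset.card_univ, ← sub_smul]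
  exact F.pos.smul_mem (sub_nonneg.2 hle) hBu

/-! ### The Riesz–Kantorovich theorem -/

/-- Extend to the real part by `x ↦ S x⁺ - S x⁻`, then complex linearly. -/
theorem exists_linear_extension {E : ConeSpace.{u}} (hE : IsComplexBanachLattice E) {V : Type u}
    [AddCommGroup V] [Module ℂ V] (S : E → V)
    (hadd : ∀ x ∈ E.pos, ∀ y ∈ E.pos, S (x + y) = S x + S y)
    (hsmul : ∀ t : ℝ, 0 ≤ t → ∀ x ∈ E.pos, S (t • x) = t • S x) :
    ∃ L : E →ₗ[ℂ] V, ∀ x ∈ E.pos, L x = S x := by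
  obtain ⟨R, _, ι, h⟩ := hE.exists_isComplexification
  have hp : ∀ {x : R}, 0 ≤ x → ι x ∈ E.pos := fun hx => h.map_mem.2 hx
  -- The value does not depend on how `x` is written as a difference of positive elements;
  -- additivity and homogeneity of `g` follow.
  have key : ∀ x a b : R, 0 ≤ a → 0 ≤ b → x = a - b →
      S (ι x⁺) - S (ι x⁻) = S (ι a) - S (ι b) := by
    intro x a b ha hb hx
    have h1 : x⁺ + b = a + x⁻ := by
      rw [← sub_eq_sub_iff_add_eq_add, posPart_sub_negPart, hx]
    rw [sub_eq_sub_iff_add_eq_add, ← hadd _ (hp (posPart_nonneg x)) _ (hp hb),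
      ← hadd _ (hp ha) _ (hp (negPart_nonneg x)), ← map_add, ← map_add, h1]
  let g : R →ₗ[ℝ] V :=
    { toFun := fun x => S (ι x⁺) - S (ι x⁻)
      map_add' := fun x y => by
        rw [key (x + y) (x⁺ + y⁺) (x⁻ + y⁻) (add_nonneg (posPart_nonneg x) (posPart_nonneg y))
          (add_nonneg (negPart_nonneg x) (negPart_nonneg y)) (by
            rw [add_sub_add_comm, posPart_sub_negPart, posPart_sub_negPart]), map_add, map_add,
          hadd _ (hp (posPart_nonneg x)) _ (hp (posPart_nonneg y)),
          hadd _ (hp (negPart_nonneg x)) _ (hp (negPart_nonneg y))]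
        abel
      map_smul' := fun t x => by
        rw [RingHom.id_apply]
        rcases le_total 0 t with ht | ht
        · rw [key (t • x) (t • x⁺) (t • x⁻) (smul_nonneg ht (posPart_nonneg x))
            (smul_nonneg ht (negPart_nonneg x)) (by rw [← smul_sub, posPart_sub_negPart]),
            map_smul, map_smul, hsmul t ht _ (hp (posPart_nonneg x)),
            hsmul t ht _ (hp (negPart_nonneg x)), smul_sub]
        · have ht' := neg_nonneg.2 ht
          rw [key (t • x) ((-t) • x⁻) ((-t) • x⁺) (smul_nonneg ht' (negPart_nonneg x))
            (smul_nonneg ht' (posPart_nonneg x)) (by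
              rw [← smul_sub, neg_smul, ← smul_neg, neg_sub, posPart_sub_negPart]),
            map_smul, map_smul, hsmul _ ht' _ (hp (posPart_nonneg x)),
            hsmul _ ht' _ (hp (negPart_nonneg x)), ← smul_sub, neg_smul, ← smul_neg, neg_sub] }
  choose re im hz using h.exists_re_im
  have hre : ∀ x y : R, re (ι x + Complex.I • ι y) = x ∧ im (ι x + Complex.I • ι y) = y :=
    fun x y => h.ext_iff (hz _).symm
  have hadd' : ∀ z w, re (z + w) = re z + re w ∧ im (z + w) = im z + im w := fun z w => by
    have : z + w = ι (re z + re w) + Complex.I • ι (im z + im w) := by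
      conv_lhs => rw [hz z, hz w]
      rw [map_add, map_add, smul_add]; abel
    rw [this]; exact hre _ _
  have hsmul' : ∀ (t : ℝ) z, re (t • z) = t • re z ∧ im (t • z) = t • im z := fun t z => by
    have : t • z = ι (t • re z) + Complex.I • ι (t • im z) := by
      conv_lhs => rw [hz z]
      rw [map_smul, map_smul, smul_add, smul_comm t]
    rw [this]; exact hre _ _
  have hI : ∀ z, re (Complex.I • z) = -im z ∧ im (Complex.I • z) = re z := fun z => by
    have : Complex.I • z = ι (-im z) + Complex.I • ι (re z) := by
      conv_lhs => rw [hz z]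
      rw [map_neg, smul_add, smul_smul, Complex.I_mul_I, neg_one_smul, add_comm]
    rw [this]; exact hre _ _
  have hLadd : ∀ z w, g (re (z + w)) + Complex.I • g (im (z + w)) =
      (g (re z) + Complex.I • g (im z)) + (g (re w) + Complex.I • g (im w)) := fun z w => by
    rw [(hadd' z w).1, (hadd' z w).2, map_add, map_add, smul_add]; abel
  have hLsmul : ∀ (t : ℝ) z, g (re (t • z)) + Complex.I • g (im (t • z)) =
      t • (g (re z) + Complex.I • g (im z)) := fun t z => by
    rw [(hsmul' t z).1, (hsmul' t z).2, map_smul, map_smul, smul_add, smul_comm t]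
  have hLI : ∀ z, g (re (Complex.I • z)) + Complex.I • g (im (Complex.I • z)) =
      Complex.I • (g (re z) + Complex.I • g (im z)) := fun z => by
    rw [(hI z).1, (hI z).2, map_neg, smul_add, smul_smul, Complex.I_mul_I, neg_one_smul, add_comm]
  have hc : ∀ {X : Type u} [AddCommGroup X] [Module ℂ X] (c : ℂ) (z : X),
      c • z = c.re • z + c.im • Complex.I • z := fun c z => by
    conv_lhs => rw [← Complex.re_add_im c]
    rw [add_smul, mul_smul]; rfl
  refine ⟨{ toFun := fun z => g (re z) + Complex.I • g (im z)
            map_add' := hLadd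
            map_smul' := fun c z => ?_ }, fun z hzp => ?_⟩
  · rw [RingHom.id_apply, hc c z, hLadd, hLsmul, hLsmul, hLI, hc c]
  · obtain ⟨x, hx, rfl⟩ := (h.mem_pos z).1 hzp
    have h1 := hre x 0
    rw [map_zero, smul_zero, add_zero] at h1
    change g (re (ι x)) + Complex.I • g (im (ι x)) = S (ι x)
    rw [h1.1, h1.2, map_zero, smul_zero, add_zero]
    have h2 := key x x 0 hx le_rfl (sub_zero x).symm
    have h3 : S 0 = 0 := by
      have := hsmul 0 le_rfl 0 E.pos.zero_mem
      simpa using this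
    rw [map_zero, h3, sub_zero] at h2
    exact h2

/-- Every nonempty set with an upper bound has a least upper bound. -/
def IsOrderComplete {V : Type u} [AddCommGroup V] [Module ℂ V] (C : PointedCone ℝ V) : Prop :=
  ∀ S : Set V, S.Nonempty → ∀ b : V, (∀ x ∈ S, b - x ∈ C) → ∃ w, IsSup C S w

/-! ### Suprema under sums, scaling, isomorphisms and translation. -/

section IsSup

variable {V W : Type u} [AddCommGroup V] [Module ℂ V] [AddCommGroup W] [Module ℂ W]
  {C : PointedCone ℝ V} {D : PointedCone ℝ W}

theorem IsSup.eq {S : Set V} {w w' : V} (h : IsSup C S w) (h' : IsSup C S w')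
    (hsal : ∀ x ∈ C, -x ∈ C → x = 0) : w = w' :=
  sub_eq_zero.1 (hsal _ (h'.2 w h.1) (by rw [neg_sub]; exact h.2 w' h'.1))

theorem IsSup.add {S S' : Set V} {w w' : V} (h : IsSup C S w) (h' : IsSup C S' w') :
    IsSup C {v | ∃ a ∈ S, ∃ b ∈ S', v = a + b} (w + w') := by
  refine ⟨?_, fun v hv => ?_⟩
  · rintro _ ⟨a, ha, b, hb, rfl⟩
    rw [add_sub_add_comm]
    exact C.add_mem (h.1 a ha) (h'.1 b hb)
  · have h1 : v - w - w' ∈ C := h'.2 _ fun b hb => by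
      rw [sub_right_comm]
      exact h.2 _ fun a ha => by
        have := hv _ ⟨a, ha, b, hb, rfl⟩
        rwa [sub_sub, add_comm b a]
    rwa [← sub_sub]

theorem IsSup.real_smul {S : Set V} {w : V} (h : IsSup C S w) {t : ℝ} (ht : 0 < t) :
    IsSup C {v | t⁻¹ • v ∈ S} (t • w) := by
  have hcancel : ∀ v : V, t • t⁻¹ • v = v := fun v => by
    rw [smul_smul, mul_inv_cancel₀ ht.ne', one_smul]
  refine ⟨fun v hv => ?_, fun v hv => ?_⟩
  · have := C.smul_mem ht.le (h.1 _ hv)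
    rwa [smul_sub, hcancel] at this
  · have := h.2 (t⁻¹ • v) fun x hx => by
      have h1 := hv (t • x) (by
        change t⁻¹ • t • x ∈ S
        rwa [smul_smul, inv_mul_cancel₀ ht.ne', one_smul])
      have h2 := C.smul_mem (inv_nonneg.2 ht.le) h1
      rwa [smul_sub, smul_smul t⁻¹ t, inv_mul_cancel₀ ht.ne', one_smul] at h2
    have h3 := C.smul_mem ht.le this
    rwa [smul_sub, hcancel] at h3

theorem IsSup.map (e : V ≃ₗ[ℂ] W) (he : ∀ v, e v ∈ D ↔ v ∈ C) {S : Set V} {w : V}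
    (h : IsSup C S w) : IsSup D (e '' S) (e w) := by
  refine ⟨?_, fun v hv => ?_⟩
  · rintro _ ⟨x, hx, rfl⟩
    rw [← map_sub, he]
    exact h.1 x hx
  · have := h.2 (e.symm v) fun x hx => by
      have := hv _ ⟨x, hx, rfl⟩
      rwa [← he, map_sub, e.apply_symm_apply]
    rwa [← he, map_sub, e.apply_symm_apply] at this

theorem IsOrderComplete.of_equiv (e : V ≃ₗ[ℂ] W) (he : ∀ v, e v ∈ D ↔ v ∈ C)
    (h : IsOrderComplete C) : IsOrderComplete D := by
  intro S hS b hb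
  obtain ⟨w, hw⟩ := h (e.symm '' S) (hS.image _) (e.symm b) (by
    rintro _ ⟨x, hx, rfl⟩
    rw [← he, ← map_sub, e.apply_symm_apply]
    exact hb x hx)
  refine ⟨e w, ?_⟩
  have := hw.map e he
  rwa [Set.image_image, show (fun x => e (e.symm x)) '' S = S by simp] at this

end IsSup

/-- A set bounded above for `F.pos` need not be real, but its elements differ by real vectors, so
translating by one of them moves the set into the real part. -/
theorem IsDedekindComplete.isOrderComplete {F : ConeSpace.{u}} (hF : IsDedekindComplete F) :
    IsOrderComplete F.pos := by
  intro S ⟨s, hs⟩ b hb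
  obtain ⟨w, -, hw⟩ := hF {x | x + s ∈ S} (fun x hx => by
      have h1 := mem_realSpan_of_mem (hb _ hx)
      have h2 := mem_realSpan_of_mem (hb _ hs)
      have := sub_mem h2 h1
      rwa [sub_sub_sub_cancel_left, add_sub_cancel_right] at this)
    ⟨0, by simpa using hs⟩ ⟨b - s, mem_realSpan_of_mem (hb s hs), fun x hx => by
      have := hb _ hx
      rwa [sub_sub, add_comm s x]⟩
  refine ⟨w + s, fun x hx => ?_, fun v hv => ?_⟩
  · have := hw.1 (x - s) (by simpa using hx)
    rwa [sub_sub_eq_add_sub] at this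
  · have := hw.2 (v - s) fun x hx => by
      have := hv _ hx
      rwa [sub_sub, add_comm s x]
    rwa [sub_right_comm, sub_sub] at this

/-- `PartitionSum E 𝒜 x v`: `v = A₁ x₁ + ⋯ + Aₙ xₙ` with `Aⱼ ∈ 𝒜`, `xⱼ ≥ 0` and
`x₁ + ⋯ + xₙ = x`. -/
inductive PartitionSum (E : ConeSpace.{u}) {V : Type u} [AddCommGroup V] [Module ℂ V]
    (𝒜 : Set (E →ₗ[ℂ] V)) : E → V → Prop
  | single {A : E →ₗ[ℂ] V} {x : E} : A ∈ 𝒜 → x ∈ E.pos → PartitionSum E 𝒜 x (A x)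
  | add {x y : E} {v w : V} : PartitionSum E 𝒜 x v → PartitionSum E 𝒜 y w →
      PartitionSum E 𝒜 (x + y) (v + w)

namespace PartitionSum

variable {E : ConeSpace.{u}} {V : Type u} [AddCommGroup V] [Module ℂ V] {𝒜 : Set (E →ₗ[ℂ] V)}

theorem mem_pos {x : E} {v : V} (h : PartitionSum E 𝒜 x v) : x ∈ E.pos := by
  induction h with
  | single _ hx => exact hx
  | add _ _ h1 h2 => exact E.pos.add_mem h1 h2

/-- Riesz decomposition refines a partition of `a + b` into partitions of `a` and of `b`; this
yields additivity of the supremum over partitions. -/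
theorem split (hE : IsComplexBanachLattice E) {x : E} {v : V} (h : PartitionSum E 𝒜 x v) :
    ∀ a ∈ E.pos, ∀ b ∈ E.pos, x = a + b →
      ∃ v₁ v₂, PartitionSum E 𝒜 a v₁ ∧ PartitionSum E 𝒜 b v₂ ∧ v = v₁ + v₂ := by
  induction h with
  | @single A x hA hx =>
    rintro a ha b hb rfl
    exact ⟨A a, A b, .single hA ha, .single hA hb, map_add _ _ _⟩
  | add h1 h2 ih1 ih2 =>
    intro a ha b hb he
    obtain ⟨p, hp, q, hq, r, hr, s, hs, hx, hy, rfl, rfl⟩ :=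
      hE.riesz_decomposition h1.mem_pos h2.mem_pos ha hb he
    obtain ⟨v₁, v₂, hv₁, hv₂, rfl⟩ := ih1 p hp q hq hx
    obtain ⟨w₁, w₂, hw₁, hw₂, rfl⟩ := ih2 r hr s hs hy
    exact ⟨v₁ + w₁, v₂ + w₂, hv₁.add hw₁, hv₂.add hw₂, by abel⟩

theorem real_smul {x : E} {v : V} (h : PartitionSum E 𝒜 x v) {t : ℝ} (ht : 0 ≤ t) :
    PartitionSum E 𝒜 (t • x) (t • v) := by
  induction h with
  | @single A x hA hx =>
    have h1 : t • A x = A (t • x) := (A.map_smul ((t : ℝ) : ℂ) x).symm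
    rw [h1]
    exact .single hA (E.pos.smul_mem ht hx)
  | add _ _ ih1 ih2 => rw [smul_add, smul_add]; exact ih1.add ih2

theorem sub_mem {C : PointedCone ℝ V} {B : E →ₗ[ℂ] V}
    (hB : ∀ A ∈ 𝒜, ∀ x ∈ E.pos, B x - A x ∈ C) {x : E} {v : V} (h : PartitionSum E 𝒜 x v) :
    B x - v ∈ C := by
  induction h with
  | single hA hx => exact hB _ hA _ hx
  | add _ _ ih1 ih2 => rw [map_add, add_sub_add_comm]; exact C.add_mem ih1 ih2

end PartitionSum

/-- The cone of positive linear maps. -/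
def positiveLinearMaps (E : ConeSpace.{u}) {V : Type u} [AddCommGroup V] [Module ℂ V]
    (C : PointedCone ℝ V) : PointedCone ℝ (E →ₗ[ℂ] V) where
  carrier := {A | ∀ x ∈ E.pos, A x ∈ C}
  zero_mem' := fun _ _ => C.zero_mem
  add_mem' := fun hA hB x hx => C.add_mem (hA x hx) (hB x hx)
  smul_mem' := fun c _ hA x hx => C.smul_mem c.2 (hA x hx)

/-- The Riesz–Kantorovich theorem. -/
theorem IsOrderComplete.positiveLinearMaps {E : ConeSpace.{u}} (hE : IsComplexBanachLattice E)
    {V : Type u} [AddCommGroup V] [Module ℂ V] {C : PointedCone ℝ V}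
    (hsal : ∀ x ∈ C, -x ∈ C → x = 0) (hC : IsOrderComplete C) :
    IsOrderComplete (_root_.positiveLinearMaps E C) := by
  intro 𝒜 ⟨A₀, hA₀⟩ B hB
  -- The Riesz–Kantorovich formula: the supremum at `x ≥ 0` is the supremum of all partition sums of
  -- `x`. Values off the cone are irrelevant.
  have hex : ∀ x, ∃ w, x ∈ E.pos → IsSup C {v | PartitionSum E 𝒜 x v} w := by
    intro x
    by_cases hx : x ∈ E.pos
    · obtain ⟨w, hw⟩ := hC {v | PartitionSum E 𝒜 x v} ⟨A₀ x, .single hA₀ hx⟩ (B x)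
        fun v hv => PartitionSum.sub_mem (fun A hA x hx => hB A hA x hx) hv
      exact ⟨w, fun _ => hw⟩
    · exact ⟨0, fun h => absurd h hx⟩
  choose S hS using hex
  have hadd : ∀ x ∈ E.pos, ∀ y ∈ E.pos, S (x + y) = S x + S y := by
    intro x hx y hy
    refine (hS _ (E.pos.add_mem hx hy)).eq ?_ hsal
    convert (hS x hx).add (hS y hy) using 1
    ext v
    constructor
    · intro hv
      obtain ⟨v₁, v₂, h1, h2, rfl⟩ := PartitionSum.split hE hv x hx y hy rfl
      exact ⟨v₁, h1, v₂, h2, rfl⟩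
    · rintro ⟨v₁, h1, v₂, h2, rfl⟩
      exact h1.add h2
  have hsmul : ∀ t : ℝ, 0 ≤ t → ∀ x ∈ E.pos, S (t • x) = t • S x := by
    intro t ht x hx
    rcases ht.eq_or_lt with rfl | ht
    · rw [zero_smul, zero_smul]
      have := hadd 0 E.pos.zero_mem 0 E.pos.zero_mem
      rwa [add_zero, left_eq_add] at this
    · refine (hS _ (E.pos.smul_mem ht.le hx)).eq ?_ hsal
      convert (hS x hx).real_smul ht using 1
      ext v
      constructor
      · intro hv
        have := hv.real_smul (inv_nonneg.2 ht.le)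
        rwa [smul_smul, inv_mul_cancel₀ ht.ne', one_smul] at this
      · intro hv
        have := PartitionSum.real_smul hv ht.le
        rwa [smul_smul, mul_inv_cancel₀ ht.ne', one_smul] at this
  obtain ⟨L, hL⟩ := exists_linear_extension hE S hadd hsmul
  refine ⟨L, fun A hA x hx => ?_, fun B' hB' x hx => ?_⟩
  · rw [LinearMap.sub_apply, hL x hx]
    exact (hS x hx).1 _ (.single hA hx)
  · rw [LinearMap.sub_apply, hL x hx]
    exact (hS x hx).2 _ fun v hv => PartitionSum.sub_mem (fun A hA x hx => hB' A hA x hx) hv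

theorem salient_positiveMaps {E : ConeSpace.{u}} (hE : IsComplexBanachLattice E) {ι : Type}
    [Finite ι] {W : Type u} [AddCommGroup W] [Module ℂ W] {C : PointedCone ℝ W}
    (hsal : ∀ x ∈ C, -x ∈ C → x = 0) (A : MultilinearMap ℂ (fun _ : ι => E) W)
    (hA : A ∈ positiveMaps ι E C) (hA' : -A ∈ positiveMaps ι E C) : A = 0 :=
  A.eq_zero_of_span _ hE.span_pos fun x hx => hsal _ (hA x hx) (hA' x hx)

/-- Currying identifies positive `(m + 1)`-linear maps with positive linear maps into `m`-linear
maps. The induction works because Riesz–Kantorovich needs no norm on the target, only a salient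
order complete cone. -/
theorem IsOrderComplete.positiveMaps {E : ConeSpace.{u}} (hE : IsComplexBanachLattice E)
    {W : Type u} [AddCommGroup W] [Module ℂ W] {C : PointedCone ℝ W}
    (hsal : ∀ x ∈ C, -x ∈ C → x = 0) (hC : IsOrderComplete C) (m : ℕ) :
    IsOrderComplete (_root_.positiveMaps (Fin m) E C) := by
  induction m with
  | zero =>
    let e : W ≃ₗ[ℂ] MultilinearMap ℂ (fun _ : Fin 0 => E) W :=
      { toFun := fun w => MultilinearMap.constOfIsEmpty ℂ _ w
        map_add' := fun _ _ => rfl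
        map_smul' := fun _ _ => rfl
        invFun := fun A => A 0
        left_inv := fun _ => rfl
        right_inv := fun A => by ext x; exact congrArg A (Subsingleton.elim _ _) }
    exact hC.of_equiv e fun w => ⟨fun h => h 0 fun i => i.elim0, fun h _ _ => h⟩
  | succ m ih =>
    have h1 : IsOrderComplete (_root_.positiveLinearMaps E (_root_.positiveMaps (Fin m) E C)) :=
      IsOrderComplete.positiveLinearMaps hE (salient_positiveMaps hE hsal) ih
    let e := (multilinearCurryLeftEquiv ℂ (fun _ : Fin (m + 1) => E.carrier) W).symm
    have he : ∀ (A : E →ₗ[ℂ] MultilinearMap ℂ (fun _ : Fin m => E) W) (x : Fin (m + 1) → E),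
        e A x = A (x 0) (Fin.tail x) := fun _ _ => rfl
    refine IsOrderComplete.of_equiv (V := E →ₗ[ℂ] MultilinearMap ℂ (fun _ : Fin m => E) W)
      (C := _root_.positiveLinearMaps E (_root_.positiveMaps (Fin m) E C)) e (fun A => ?_) h1
    constructor
    · intro h x hx y hy
      have := h (Fin.cons x y) (Fin.cases hx hy)
      rwa [he, Fin.cons_zero, Fin.tail_cons] at this
    · intro h x hx
      rw [he]
      exact h (x 0) (hx 0) _ fun i => hx _

/-! ### Complex Banach lattices from cones -/

section RealPart

variable {V : Type u} [AddCommGroup V] [Module ℂ V] {C : PointedCone ℝ V}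

theorem IsSup.mem_realSpan {S : Set V} (hS : S ⊆ realSpan C) (hne : S.Nonempty) {w : V}
    (h : IsSup C S w) : w ∈ realSpan C := by
  obtain ⟨s, hs⟩ := hne
  have := add_mem (mem_realSpan_of_mem (h.1 s hs)) (hS hs)
  rwa [sub_add_cancel] at this

theorem IsOrderComplete.exists_isModulus (hC : IsOrderComplete C) {x y : V}
    (hx : x ∈ realSpan C) (hy : y ∈ realSpan C) : ∃ w, IsModulus C (x + Complex.I • y) w := by
  obtain ⟨a, ha, b, hb, rfl⟩ := mem_realSpan_iff.1 hx
  obtain ⟨c, hc, d, hd, rfl⟩ := mem_realSpan_iff.1 hy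
  -- `a + b + (c + d)` is an upper bound because `|cos t|` and `|sin t|` are at most `1`.
  obtain ⟨w, hw⟩ := hC (Set.range fun t : ℝ => Real.cos t • (a - b) + Real.sin t • (c - d))
    ⟨_, 0, rfl⟩ (a + b + (c + d)) (by
      rintro _ ⟨t, rfl⟩
      have key : ∀ (s : ℝ), |s| ≤ 1 → ∀ a ∈ C, ∀ b ∈ C, a + b - s • (a - b) ∈ C := by
        intro s hs a ha b hb
        have h1 := C.add_mem (C.smul_mem (sub_nonneg.2 (abs_le.1 hs).2) ha)
          (C.smul_mem (neg_le_iff_add_nonneg'.1 (abs_le.1 hs).1) hb)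
        convert h1 using 1
        rw [sub_smul, add_smul, smul_sub, one_smul, one_smul]; abel
      have := C.add_mem (key _ (Real.abs_cos_le_one t) a ha b hb)
        (key _ (Real.abs_sin_le_one t) c hc d hd)
      convert this using 1
      simp only; abel)
  exact ⟨w, _, hx, _, hy, rfl, hw⟩

theorem IsOrderComplete.exists_isSup_pair (hC : IsOrderComplete C) (x y : realSpan C) :
    ∃ w : realSpan C, IsSup C {(x : V), (y : V)} (w : V) := by
  obtain ⟨a, ha, b, hb, hx⟩ := mem_realSpan_iff.1 x.2
  obtain ⟨c, hc, d, hd, hy⟩ := mem_realSpan_iff.1 y.2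
  obtain ⟨w, hw⟩ := hC {(x : V), (y : V)} ⟨x, by simp⟩ (a + c) (by
    rintro z (h | h) <;> rw [h]
    · rw [hx, show a + c - (a - b) = c + b by abel]; exact C.add_mem hc hb
    · rw [hy, show a + c - (c - d) = a + d by abel]; exact C.add_mem ha hd)
  refine ⟨⟨w, IsSup.mem_realSpan (S := {(x : V), (y : V)}) ?_ ⟨(x : V), Or.inl rfl⟩ hw⟩, hw⟩
  rintro z (h | h) <;> rw [h]
  exacts [x.2, y.2]

/-- The real part of an order complete space is a lattice. -/
noncomputable abbrev realSpanLattice (hsal : ∀ x ∈ C, -x ∈ C → x = 0) (hC : IsOrderComplete C) :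
    Lattice (realSpan C) :=
  let sup : realSpan C → realSpan C → realSpan C := fun x y => (hC.exists_isSup_pair x y).choose
  have hsup : ∀ x y : realSpan C, IsSup C {(x : V), (y : V)} (sup x y : realSpan C) := fun x y =>
    (hC.exists_isSup_pair x y).choose_spec
  have hl : ∀ x y : realSpan C, ((sup x y : realSpan C) : V) - x ∈ C := fun x y => (hsup x y).1 x (by simp)
  have hr : ∀ x y : realSpan C, ((sup x y : realSpan C) : V) - y ∈ C := fun x y => (hsup x y).1 y (by simp)
  have hle : ∀ x y z : realSpan C, (z : V) - x ∈ C → (z : V) - y ∈ C → (z : V) - (sup x y : realSpan C) ∈ C :=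
    fun x y z h1 h2 => (hsup x y).2 z (by rintro v (h | h) <;> rw [h] <;> assumption)
  { le := fun x y => (y : V) - x ∈ C
    le_refl := fun x => by simp [C.zero_mem]
    le_trans := fun x y z h1 h2 => by
      have := C.add_mem h2 h1
      rwa [sub_add_sub_cancel] at this
    le_antisymm := fun x y h1 h2 => Subtype.ext
      (sub_eq_zero.1 (hsal _ h2 (by rwa [neg_sub])))
    sup := sup
    le_sup_left := hl
    le_sup_right := hr
    sup_le := hle
    inf := fun x y => -sup (-x) (-y)
    inf_le_left := fun x y => by
      have := hl (-x) (-y)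
      simpa [sub_neg_eq_add, add_comm] using this
    inf_le_right := fun x y => by
      have := hr (-x) (-y)
      simpa [sub_neg_eq_add, add_comm] using this
    le_inf := fun x y z h1 h2 => by
      have := hle (-y) (-z) (-x) (by simpa [sub_eq_add_neg, add_comm] using h1)
        (by simpa [sub_eq_add_neg, add_comm] using h2)
      simpa [sub_eq_add_neg, add_comm] using this }

end RealPart

theorem smul_le_abs_smul_abs {R : Type*} [AddCommGroup R] [Lattice R] [IsOrderedAddMonoid R]
    [Module ℝ R] [PosSMulMono ℝ R] (t : ℝ) (x : R) : t • x ≤ |t| • |x| := by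
  rcases le_total 0 t with h | h
  · rw [abs_of_nonneg h]; exact smul_le_smul_of_nonneg_left (le_abs_self x) h
  · rw [abs_of_nonpos h, ← neg_smul_neg]
    exact smul_le_smul_of_nonneg_left (neg_le_abs x) (neg_nonneg.2 h)

/-- Order completeness supplies the lattice and the moduli, so apart from `hmod` the norm has to be
checked only on the cone. Completeness is likewise asked only for series of positive terms. -/
theorem isComplexBanachLattice_of_cone (V : ConeSpace.{u})
    (hsal : ∀ x ∈ V.pos, -x ∈ V.pos → x = 0)
    (huniq : ∀ x ∈ realSpan V.pos, Complex.I • x ∈ realSpan V.pos → x = 0)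
    (hreim : ∀ z : V, ∃ x ∈ realSpan V.pos, ∃ y ∈ realSpan V.pos, z = x + Complex.I • y)
    (hC : IsOrderComplete V.pos)
    (hmono : ∀ x ∈ V.pos, ∀ y : V, y - x ∈ V.pos → ‖x‖ ≤ ‖y‖)
    (hadd : ∀ x ∈ V.pos, ∀ y ∈ V.pos, ‖x + y‖ ≤ ‖x‖ + ‖y‖)
    (hsmul : ∀ t : ℝ, 0 ≤ t → ∀ x ∈ V.pos, ‖t • x‖ = t * ‖x‖)
    (hzero : ∀ x ∈ V.pos, ‖x‖ = 0 → x = 0)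
    (hmod : ∀ z w : V, IsModulus V.pos z w → ‖z‖ = ‖w‖)
    (hcompl : ∀ c : ℕ → V, (∀ n, c n ∈ V.pos) → Summable (fun n => ‖c n‖) →
      ∃ s : V, (∀ n, s - ∑ i ∈ Finset.range n, c i ∈ V.pos) ∧
        Filter.Tendsto (fun n => ‖s - ∑ i ∈ Finset.range n, c i‖) Filter.atTop (nhds 0)) :
    IsComplexBanachLattice V := by
  let _ : Lattice (realSpan V.pos) := realSpanLattice hsal hC
  have le_def : ∀ {x y : realSpan V.pos}, x ≤ y ↔ (y : V) - x ∈ V.pos := Iff.rfl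
  have nonneg_def : ∀ {x : realSpan V.pos}, 0 ≤ x ↔ (x : V) ∈ V.pos := fun {x} => by
    rw [le_def, Submodule.coe_zero, sub_zero]
  have _ : IsOrderedAddMonoid (realSpan V.pos) :=
    { add_le_add_left := fun x y h z => by
        rw [le_def] at h ⊢
        simpa using h }
  have _ : PosSMulMono ℝ (realSpan V.pos) := ⟨fun t ht x y h => by
    rw [le_def] at h ⊢
    have := V.pos.smul_mem ht h
    rwa [smul_sub] at this⟩
  -- Defining the real norm through `|x|` makes solidity immediate from `hmono`.
  let _ : Norm (realSpan V.pos) := ⟨fun x => ‖((|x| : realSpan V.pos) : V)‖⟩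
  have norm_def : ∀ x : realSpan V.pos, ‖x‖ = ‖((|x| : realSpan V.pos) : V)‖ := fun _ => rfl
  have h0 : ‖(0 : V)‖ = 0 := by
    have := hsmul 0 le_rfl 0 V.pos.zero_mem
    rwa [zero_smul, zero_mul] at this
  have hpos : ∀ x : realSpan V.pos, ((|x| : realSpan V.pos) : V) ∈ V.pos := fun x =>
    nonneg_def.1 (abs_nonneg x)
  have hnn : ∀ x ∈ V.pos, 0 ≤ ‖x‖ := fun x hx => by
    rw [← h0]; exact hmono 0 V.pos.zero_mem x (by rwa [sub_zero])
  have hsolid : ∀ x y : realSpan V.pos, |x| ≤ |y| → ‖x‖ ≤ ‖y‖ := fun x y h =>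
    hmono _ (hpos x) _ (le_def.1 h)
  have hle : ∀ (t : ℝ) (x : realSpan V.pos), ‖t • x‖ ≤ |t| * ‖x‖ := fun t x => by
    rw [norm_def, norm_def, ← hsmul _ (abs_nonneg t) _ (hpos x)]
    refine hmono _ (hpos _) _ ((le_def (y := |t| • |x|)).1 (abs_le'.2 ⟨smul_le_abs_smul_abs t x, ?_⟩))
    have := smul_le_abs_smul_abs (-t) x
    rwa [neg_smul, abs_neg] at this
  have core : NormedSpace.Core ℝ (realSpan V.pos) :=
    { norm_nonneg := fun x => hnn _ (hpos x)
      norm_triangle := fun x y => by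
        refine (hmono _ (hpos _) _ ((le_def (y := |x| + |y|)).1 (abs_add_le x y))).trans ?_
        exact hadd _ (hpos x) _ (hpos y)
      norm_smul := fun t x => by
        refine le_antisymm (hle t x) ?_
        rcases eq_or_ne t 0 with rfl | ht
        · rw [norm_zero, zero_mul]; exact hnn _ (hpos _)
        · have := hle t⁻¹ (t • x)
          rw [smul_smul, inv_mul_cancel₀ ht, one_smul, abs_inv] at this
          rwa [Real.norm_eq_abs, ← le_inv_mul_iff₀ (abs_pos.2 ht)]
      norm_eq_zero_iff := fun x => by
        constructor
        · intro h
          have h1 : |x| = 0 := Subtype.ext (hzero _ (hpos x) h)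
          exact le_antisymm (h1 ▸ le_abs_self x) (neg_nonpos.1 (h1 ▸ neg_le_abs x))
        · rintro rfl
          rw [norm_def, abs_zero]; exact h0 }
  let _ : NormedAddCommGroup (realSpan V.pos) := NormedAddCommGroup.ofCore core
  let _ : NormedSpace ℝ (realSpan V.pos) := NormedSpace.ofCore core
  have _ : HasSolidNorm (realSpan V.pos) := ⟨fun x y h => hsolid x y h⟩
  have norm_of_nonneg : ∀ x : realSpan V.pos, 0 ≤ x → ‖x‖ = ‖(x : V)‖ := fun x hx => by
    rw [norm_def, abs_of_nonneg hx]
  have hser : ∀ u : ℕ → realSpan V.pos, (∀ n, 0 ≤ u n) → Summable (fun n => ‖u n‖) →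
      ∃ a, Filter.Tendsto (fun n => ∑ i ∈ Finset.range n, u i) Filter.atTop (nhds a) := by
    intro u hu hs
    obtain ⟨s, hs1, hs2⟩ := hcompl (fun n => u n) (fun n => nonneg_def.1 (hu n))
      (by simpa only [norm_of_nonneg _ (hu _)] using hs)
    have hs3 : s ∈ realSpan V.pos := by
      have := mem_realSpan_of_mem (hs1 0)
      simpa using this
    refine ⟨⟨s, hs3⟩, tendsto_iff_norm_sub_tendsto_zero.2 ?_⟩
    refine hs2.congr fun n => ?_
    have h1 : ((⟨s, hs3⟩ - ∑ i ∈ Finset.range n, u i : realSpan V.pos) : V)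
        = s - ∑ i ∈ Finset.range n, (u i : V) := by
      rw [Submodule.coe_sub, Submodule.coe_sum]
    rw [norm_sub_rev, norm_of_nonneg _ (nonneg_def.2 (by rw [h1]; exact hs1 n)), h1]
  have _ : CompleteSpace (realSpan V.pos) := by
    -- An absolutely convergent series splits into positive and negative parts, each norm summable
    -- by solidity.
    refine NormedAddCommGroup.completeSpace_of_summable_imp_tendsto fun u hu => ?_
    obtain ⟨a, ha⟩ := hser (fun n => (u n)⁺) (fun n => posPart_nonneg _)
      (Summable.of_nonneg_of_le (fun n => norm_nonneg _) (fun n => hsolid _ _ (by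
        rw [abs_of_nonneg (posPart_nonneg _)]
        exact sup_le (le_abs_self _) (abs_nonneg _))) hu)
    obtain ⟨b, hb⟩ := hser (fun n => (u n)⁻) (fun n => negPart_nonneg _)
      (Summable.of_nonneg_of_le (fun n => norm_nonneg _) (fun n => hsolid _ _ (by
        rw [abs_of_nonneg (negPart_nonneg _)]
        exact sup_le (neg_le_abs _) (abs_nonneg _))) hu)
    refine ⟨a - b, (ha.sub hb).congr fun n => ?_⟩
    rw [← Finset.sum_sub_distrib]
    exact Finset.sum_congr rfl fun i _ => posPart_sub_negPart _
  let _ : RealBanachLattice (realSpan V.pos) := {}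
  refine ⟨realSpan V.pos, inferInstance, (realSpan V.pos).subtype, fun z => ?_, fun z => ?_,
    fun x y => ?_⟩
  · obtain ⟨x, hx, y, hy, rfl⟩ := hreim z
    refine ⟨(⟨x, hx⟩, ⟨y, hy⟩), rfl, fun p hp => ?_⟩
    obtain ⟨h1, h2⟩ := eq_and_eq_of_add_I_smul huniq hx hy p.1.2 p.2.2 hp
    exact Prod.ext (Subtype.ext h1.symm) (Subtype.ext h2.symm)
  · constructor
    · exact fun hz => ⟨⟨z, mem_realSpan_of_mem hz⟩, nonneg_def.2 hz, rfl⟩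
    · rintro ⟨x, hx, rfl⟩
      exact nonneg_def.1 hx
  · obtain ⟨w, hw⟩ := hC.exists_isModulus x.2 y.2
    have hwp : w ∈ V.pos := hw.dominates.mem
    refine ⟨⟨w, mem_realSpan_of_mem hwp⟩, ⟨?_, fun v hv => ?_⟩, ?_⟩
    · rintro _ ⟨t, rfl⟩
      obtain ⟨x', hx', y', hy', he, hs⟩ := hw
      obtain ⟨h1, h2⟩ := eq_and_eq_of_add_I_smul huniq x.2 y.2 hx' hy' he
      rw [le_def]
      have := hs.1 _ ⟨t, rfl⟩
      rw [← h1, ← h2] at this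
      exact this
    · rw [le_def]
      refine hw.sub_mem ⟨x, x.2, y, y.2, rfl, fun t => ?_⟩ huniq
      exact le_def.1 (hv ⟨t, rfl⟩)
    · rw [norm_of_nonneg _ (nonneg_def.2 hwp)]
      exact hmod _ _ hw

/-! ### Regular polynomials and their symmetric multilinear maps -/

section Regular

variable {m : ℕ} {E F : ConeSpace.{u}}

namespace Generates

variable {A B : MultilinearMap ℂ (fun _ : Fin m => E) F} {P Q : E → F}

theorem add (hA : Generates A P) (hB : Generates B Q) : Generates (A + B) (P + Q) :=
  ⟨fun π x => by rw [add_apply, add_apply, hA.1, hB.1], fun x => by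
    rw [add_apply, Pi.add_apply, hA.2, hB.2]⟩

theorem smul (hA : Generates A P) (c : ℂ) : Generates (c • A) (c • P) :=
  ⟨fun π x => by rw [smul_apply, smul_apply, hA.1], fun x => by
    rw [smul_apply, Pi.smul_apply, hA.2]⟩

theorem sub (hA : Generates A P) (hB : Generates B Q) : Generates (A - B) (P - Q) := by
  have := hA.add (hB.smul (-1))
  rwa [neg_one_smul, neg_one_smul, ← sub_eq_add_neg, ← sub_eq_add_neg] at this

theorem unique (hA : Generates A P) (hB : Generates B P) : A = B := by
  have h := hA.sub hB
  rw [sub_self] at h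
  exact sub_eq_zero.1 ((A - B).eq_zero_of_diagonal h.1 fun x => (h.2 x).symm)

theorem mem_posPoly_iff (hA : Generates A P) :
    P ∈ posPoly m E F ↔ A ∈ positiveMaps (Fin m) E F.pos := by
  refine ⟨fun ⟨B, hB, hB'⟩ => ?_, fun h => ⟨A, hA, h⟩⟩
  rw [hA.unique hB]
  exact hB'

end Generates

theorem IsRealRegular.of_mem_posPoly {P : E → F} (hP : P ∈ posPoly m E F) :
    IsRealRegular m E F P := ⟨P, hP, 0, zero_mem _, (sub_zero P).symm⟩

theorem IsRealRegular.mem_regPoly {P : E → F} (hP : IsRealRegular m E F P) :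
    P ∈ regPoly m E F :=
  ⟨P, 0, hP, IsRealRegular.of_mem_posPoly (zero_mem _), by simp⟩

theorem posPoly_le_regPoly {P : E → F} (hP : P ∈ posPoly m E F) : P ∈ regPoly m E F :=
  (IsRealRegular.of_mem_posPoly hP).mem_regPoly

theorem IsRealRegular.exists_generates {P : E → F} (hP : IsRealRegular m E F P) :
    ∃ A : MultilinearMap ℂ (fun _ : Fin m => E) F, Generates A P := by
  obtain ⟨P₁, ⟨A, hA, -⟩, P₂, ⟨B, hB, -⟩, rfl⟩ := hP
  exact ⟨_, hA.sub hB⟩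

theorem regPoly_exists_generates (P : regPoly m E F) :
    ∃ A : MultilinearMap ℂ (fun _ : Fin m => E) F, Generates A (P : E → F) := by
  obtain ⟨P, P₀, P₁, h0, h1, rfl⟩ := P
  obtain ⟨A, hA⟩ := h0.exists_generates
  obtain ⟨B, hB⟩ := h1.exists_generates
  exact ⟨_, hA.add (hB.smul Complex.I)⟩

/-- The symmetric multilinear map generating a regular polynomial. -/
noncomputable def polarForm :
    regPoly m E F →ₗ[ℂ] MultilinearMap ℂ (fun _ : Fin m => E) F where
  toFun P := (regPoly_exists_generates P).choose
  map_add' P Q := (regPoly_exists_generates (P + Q)).choose_spec.unique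
    ((regPoly_exists_generates P).choose_spec.add (regPoly_exists_generates Q).choose_spec)
  map_smul' c P := (regPoly_exists_generates (c • P)).choose_spec.unique
    ((regPoly_exists_generates P).choose_spec.smul c)

theorem generates_polarForm (P : regPoly m E F) : Generates (polarForm P) (P : E → F) :=
  (regPoly_exists_generates P).choose_spec

theorem polarForm_diag (P : regPoly m E F) (x : E) :
    polarForm P (fun _ => x) = (P : E → F) x := ((generates_polarForm P).2 x).symm

theorem polarForm_eq {P : regPoly m E F} {A : MultilinearMap ℂ (fun _ : Fin m => E) F}
    (hA : Generates A (P : E → F)) : polarForm P = A := (generates_polarForm P).unique hA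

theorem polarForm_injective {P : regPoly m E F} (h : polarForm P = 0) : P = 0 := by
  refine Subtype.ext (funext fun x => ?_)
  rw [← polarForm_diag, h]
  rfl

theorem mem_regPolyPos_iff {P : regPoly m E F} :
    P ∈ regPolyPos m E F ↔ polarForm P ∈ positiveMaps (Fin m) E F.pos :=
  (generates_polarForm P).mem_posPoly_iff

theorem polarForm_real_smul (t : ℝ) (P : regPoly m E F) : polarForm (t • P) = t • polarForm P :=
  polarForm.map_smul (t : ℂ) P

theorem exists_polarForm_eq {A : MultilinearMap ℂ (fun _ : Fin m => E) F}
    (hs : ∀ (π : Equiv.Perm (Fin m)) (x : Fin m → E), A (fun i => x (π i)) = A x)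
    (hA : A ∈ positiveMaps (Fin m) E F.pos) :
    ∃ P ∈ regPolyPos m E F, polarForm P = A := by
  have hg : Generates A fun x => A fun _ => x := ⟨hs, fun _ => rfl⟩
  let P : regPoly m E F := ⟨fun x => A fun _ => x, posPoly_le_regPoly (hg.mem_posPoly_iff.2 hA)⟩
  exact ⟨P, hg.mem_posPoly_iff.2 hA, polarForm_eq hg⟩

theorem IsRealRegular.mem_realSpan {P : E → F} (hP : IsRealRegular m E F P) :
    (⟨P, hP.mem_regPoly⟩ : regPoly m E F) ∈ realSpan (regPolyPos m E F) := by
  obtain ⟨P₁, h1, P₂, h2, rfl⟩ := hP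
  exact mem_realSpan_iff.2 ⟨⟨P₁, posPoly_le_regPoly h1⟩, h1, ⟨P₂, posPoly_le_regPoly h2⟩, h2, rfl⟩

theorem regPoly_exists_re_im (P : regPoly m E F) : ∃ P₀ ∈ realSpan (regPolyPos m E F),
    ∃ P₁ ∈ realSpan (regPolyPos m E F), P = P₀ + Complex.I • P₁ := by
  obtain ⟨P, P₀, P₁, h0, h1, rfl⟩ := P
  exact ⟨_, h0.mem_realSpan, _, h1.mem_realSpan, rfl⟩

theorem polarForm_mem_realSpan {P : regPoly m E F} (hP : P ∈ realSpan (regPolyPos m E F))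
    {x : Fin m → E} (hx : ∀ i, x i ∈ E.pos) : polarForm P x ∈ realSpan F.pos := by
  obtain ⟨P₁, h1, P₂, h2, rfl⟩ := mem_realSpan_iff.1 hP
  rw [map_sub, sub_apply]
  exact mem_realSpan_iff.2 ⟨_, mem_regPolyPos_iff.1 h1 x hx, _, mem_regPolyPos_iff.1 h2 x hx, rfl⟩

theorem regPoly_salient (hE : IsComplexBanachLattice E) (hF : IsComplexBanachLattice F)
    (P : regPoly m E F) (hP : P ∈ regPolyPos m E F) (hP' : -P ∈ regPolyPos m E F) : P = 0 := by
  rw [mem_regPolyPos_iff] at hP hP'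
  rw [map_neg] at hP'
  exact polarForm_injective (salient_positiveMaps hE hF.salient _ hP hP')

theorem regPoly_eq_zero_of_I_smul (hE : IsComplexBanachLattice E) (hF : IsComplexBanachLattice F)
    (P : regPoly m E F) (hP : P ∈ realSpan (regPolyPos m E F))
    (hP' : Complex.I • P ∈ realSpan (regPolyPos m E F)) : P = 0 := by
  refine polarForm_injective ((polarForm P).eq_zero_of_span _ hE.span_pos fun x hx => ?_)
  refine hF.eq_zero_of_I_smul _ (polarForm_mem_realSpan hP hx) ?_
  have := polarForm_mem_realSpan hP' hx
  rwa [map_smul, smul_apply] at this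

/-- The supremum is taken among all multilinear maps. Permuting arguments is an order automorphism
fixing every polar form, hence it fixes their supremum, which is therefore symmetric. -/
theorem regPoly_isOrderComplete (hE : IsComplexBanachLattice E) (hF : IsComplexBanachLattice F)
    (hD : IsDedekindComplete F) : IsOrderComplete (regPolyPos m E F) := by
  intro S ⟨s, hs⟩ b hb
  have hoc := IsOrderComplete.positiveMaps hE hF.salient hD.isOrderComplete m
  obtain ⟨w, hw⟩ := hoc (polarForm '' S) ⟨_, s, hs, rfl⟩ (polarForm b) (by
    rintro _ ⟨P, hP, rfl⟩
    rw [← map_sub]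
    exact mem_regPolyPos_iff.1 (hb P hP))
  have hsymm : ∀ (π : Equiv.Perm (Fin m)) (x : Fin m → E), w (fun i => x (π i)) = w x := by
    intro π x
    let e := MultilinearMap.domDomCongrLinearEquiv ℂ ℂ E.carrier F.carrier π
    have he : ∀ (A : MultilinearMap ℂ (fun _ : Fin m => E) F) (x : Fin m → E),
        e A x = A fun i => x (π i) := fun _ _ => rfl
    have h1 := hw.map (D := positiveMaps (Fin m) E F.pos) e fun A => by
      constructor
      · intro h y hy
        have := h (fun i => y (π.symm i)) fun i => hy _
        rw [he] at this
        simpa using this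
      · intro h y hy
        rw [he]
        exact h _ fun i => hy _
    have h2 : e '' (polarForm '' S) = polarForm '' S := by
      have h3 : ∀ P : regPoly m E F, e (polarForm P) = polarForm P := fun P => by
        ext y
        rw [he]
        exact (generates_polarForm P).1 π y
      rw [Set.image_image]
      simp only [h3]
    rw [h2] at h1
    have h4 := hw.eq h1 (salient_positiveMaps hE hF.salient)
    conv_rhs => rw [h4]
    rfl
  -- `w` itself need not be positive, but it exceeds the polar form of a member of `S` by a positive
  -- symmetric map, so it comes from a regular polynomial.
  obtain ⟨Q, -, hQ⟩ := exists_polarForm_eq (A := w - polarForm s) (fun π x => by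
    rw [sub_apply, sub_apply, hsymm,
      (generates_polarForm s).1]) (hw.1 _ ⟨s, hs, rfl⟩)
  have hwf : polarForm (Q + s) = w := by rw [map_add, hQ, sub_add_cancel]
  refine ⟨Q + s, fun P hP => ?_, fun v hv => ?_⟩
  · rw [mem_regPolyPos_iff, map_sub, hwf]
    exact hw.1 _ ⟨P, hP, rfl⟩
  · rw [mem_regPolyPos_iff, map_sub, hwf]
    refine hw.2 _ ?_
    rintro _ ⟨P, hP, rfl⟩
    rw [← map_sub]
    exact mem_regPolyPos_iff.1 (hv P hP)

theorem regPoly_exists_isModulus (hE : IsComplexBanachLattice E) (hF : IsComplexBanachLattice F)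
    (hD : IsDedekindComplete F) (P : regPoly m E F) : ∃ Q, IsModulus (regPolyPos m E F) P Q := by
  obtain ⟨P₀, h0, P₁, h1, rfl⟩ := regPoly_exists_re_im P
  exact (regPoly_isOrderComplete hE hF hD).exists_isModulus h0 h1

/-- At positive arguments the polar forms of the real and imaginary parts are real, so uniqueness of
parts in `F` turns domination into a pointwise condition. -/
theorem regPoly_dominates_iff (hF : IsComplexBanachLattice F) {P Q : regPoly m E F} :
    Dominates (regPolyPos m E F) P Q ↔
      ∀ x : Fin m → E, (∀ i, x i ∈ E.pos) → Dominates F.pos (polarForm P x) (polarForm Q x) := by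
  have key : ∀ (P₀ P₁ : regPoly m E F) (t : ℝ) (x : Fin m → E),
      polarForm (Q - (Real.cos t • P₀ + Real.sin t • P₁)) x = polarForm Q x -
        (Real.cos t • polarForm P₀ x + Real.sin t • polarForm P₁ x) := fun P₀ P₁ t x => by
    rw [map_sub, map_add, polarForm_real_smul, polarForm_real_smul]
    rfl
  have key' : ∀ (P₀ P₁ : regPoly m E F) (x : Fin m → E), polarForm (P₀ + Complex.I • P₁) x =
      polarForm P₀ x + Complex.I • polarForm P₁ x := fun P₀ P₁ x => by
    rw [map_add, map_smul]
    rfl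
  constructor
  · rintro ⟨P₀, h0, P₁, h1, rfl, hs⟩ x hx
    refine ⟨_, polarForm_mem_realSpan h0 hx, _, polarForm_mem_realSpan h1 hx, key' _ _ _,
      fun t => ?_⟩
    rw [← key]
    exact mem_regPolyPos_iff.1 (hs t) x hx
  · intro h
    obtain ⟨P₀, h0, P₁, h1, rfl⟩ := regPoly_exists_re_im P
    refine ⟨P₀, h0, P₁, h1, rfl, fun t => mem_regPolyPos_iff.2 fun x hx => ?_⟩
    obtain ⟨a, ha, b, hb, he, hs⟩ := h x hx
    rw [key'] at he
    obtain ⟨rfl, rfl⟩ := eq_and_eq_of_add_I_smul hF.eq_zero_of_I_smul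
      (polarForm_mem_realSpan h0 hx) (polarForm_mem_realSpan h1 hx) ha hb he
    rw [key]
    exact hs t

theorem Dominates.polarForm_apply (hE : IsComplexBanachLattice E)
    (hF : IsComplexBanachLattice F) {P Q : regPoly m E F} (h : Dominates (regPolyPos m E F) P Q)
    {z u : Fin m → E} (hz : ∀ i, Dominates E.pos (z i) (u i)) :
    Dominates F.pos (polarForm P z) (polarForm Q u) :=
  Dominates.map_multilinear hE hF ((regPoly_dominates_iff hF).1 h) hz

theorem Dominates.poly_apply (hE : IsComplexBanachLattice E)
    (hF : IsComplexBanachLattice F) {P Q : regPoly m E F} (h : Dominates (regPolyPos m E F) P Q)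
    {z u : E} (hz : Dominates E.pos z u) :
    Dominates F.pos ((P : E → F) z) ((Q : E → F) u) := by
  rw [← polarForm_diag, ← polarForm_diag]
  exact h.polarForm_apply hE hF fun _ => hz

/-! ### The regular norm -/

theorem regPoly_apply_smul (P : regPoly m E F) (c : ℂ) (z : E) :
    (P : E → F) (c • z) = c ^ m • (P : E → F) z := by
  rw [← polarForm_diag, ← polarForm_diag]
  have := (polarForm P).map_smul_univ (fun _ => c) (fun _ => z)
  rwa [Finset.prod_const, Finset.card_univ, Fintype.card_fin] at this

theorem regNorm_eq (hE : IsComplexBanachLattice E) (hF : IsComplexBanachLattice F)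
    {P Q : regPoly m E F} (h : IsModulus (regPolyPos m E F) P Q) :
    regNorm m E F P = supNorm (Q : E → F) := by
  have hex : ∃ Q, IsModulus (regPolyPos m E F) P Q := ⟨Q, h⟩
  rw [regNorm, dif_pos hex,
    hex.choose_spec.eq h (regPoly_eq_zero_of_I_smul hE hF) (regPoly_salient hE hF)]

theorem regNorm_of_mem (hE : IsComplexBanachLattice E) (hF : IsComplexBanachLattice F)
    {P : regPoly m E F} (h : P ∈ regPolyPos m E F) : regNorm m E F P = supNorm (P : E → F) :=
  regNorm_eq hE hF (IsModulus.of_mem h)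

theorem norm_apply_le_norm_apply (hE : IsComplexBanachLattice E) (hF : IsComplexBanachLattice F)
    {P Q : regPoly m E F} (h : Dominates (regPolyPos m E F) P Q) {z w : E}
    (hz : Dominates E.pos z w) : ‖(P : E → F) z‖ ≤ ‖(Q : E → F) w‖ :=
  hF.norm_le_of_dominates (h.poly_apply hE hF hz)

/-- Positive polynomials are automatically bounded. Otherwise choose `rₙ ≥ 0` in the unit ball with
`‖Q rₙ‖ > n 2^(nm)`; the sum of all `2⁻ⁿ rₙ` lies above each term, so the norm of `Q` there exceeds
every `n`. -/
theorem exists_norm_bound (hE : IsComplexBanachLattice E) (hF : IsComplexBanachLattice F)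
    {Q : regPoly m E F} (hQ : Q ∈ regPolyPos m E F) :
    ∃ K : ℝ, ∀ z : E, ‖z‖ ≤ 1 → ‖(Q : E → F) z‖ ≤ K := by
  by_contra hcon
  push Not at hcon
  obtain ⟨R, _, ι, h⟩ := hE.exists_isComplexification
  have h1 : ∀ n : ℕ, ∃ r : R, 0 ≤ r ∧ ‖r‖ ≤ 1 ∧ n * (2 ^ n) ^ m < ‖(Q : E → F) (ι r)‖ := by
    intro n
    obtain ⟨z, hz, hn⟩ := hcon (n * (2 ^ n) ^ m)
    obtain ⟨x, y, rfl⟩ := h.exists_re_im z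
    obtain ⟨r, hr, hm, hnr⟩ := h.exists_isModulus x y
    exact ⟨r, hr, hnr ▸ hz,
      hn.trans_le (norm_apply_le_norm_apply hE hF (Dominates.of_mem hQ) hm.dominates)⟩
  choose r hr hr1 hrn using h1
  have hs : Summable fun n => ((1 / 2 : ℝ) ^ n) • r n := by
    refine Summable.of_norm_bounded summable_geometric_two fun n => ?_
    rw [norm_smul, Real.norm_of_nonneg (by positivity)]
    exact mul_le_of_le_one_right (by positivity) (hr1 n)
  obtain ⟨n, hn⟩ := exists_nat_gt ‖(Q : E → F) (ι (∑' n, ((1 / 2 : ℝ) ^ n) • r n))‖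
  have h2 : ((1 / 2 : ℝ) ^ n) • r n ≤ ∑' n, ((1 / 2 : ℝ) ^ n) • r n :=
    hs.le_tsum n fun j _ => smul_nonneg (by positivity) (hr j)
  have h3 : 0 ≤ ((1 / 2 : ℝ) ^ n) • r n := smul_nonneg (by positivity) (hr n)
  have h4 := norm_apply_le_norm_apply hE hF (Dominates.of_mem hQ)
    ((Dominates.of_mem (h.map_mem.2 h3)).mono (h.map_sub_mem.2 h2))
  have h5 : ι (((1 / 2 : ℝ) ^ n) • r n) = (((1 / 2 : ℝ) ^ n : ℝ) : ℂ) • ι (r n) := map_smul _ _ _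
  rw [h5, regPoly_apply_smul, hF.isBanach.core.norm_smul, norm_pow, Complex.norm_real,
    Real.norm_of_nonneg (by positivity)] at h4
  have h6 : ((1 / 2 : ℝ) ^ n) ^ m * (n * (2 ^ n) ^ m) < ((1 / 2 : ℝ) ^ n) ^ m *
      ‖(Q : E → F) (ι (r n))‖ := mul_lt_mul_of_pos_left (hrn n) (by positivity)
  have h7 : ((1 / 2 : ℝ) ^ n) ^ m * (n * (2 ^ n) ^ m) = n := by
    rw [mul_left_comm, ← mul_pow, ← mul_pow]; norm_num
  linarith

theorem norm_apply_le_supNorm (hE : IsComplexBanachLattice E) (hF : IsComplexBanachLattice F)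
    {Q : regPoly m E F} (hQ : Q ∈ regPolyPos m E F) {z : E} (hz : ‖z‖ ≤ 1) :
    ‖(Q : E → F) z‖ ≤ supNorm (Q : E → F) := by
  obtain ⟨K, hK⟩ := exists_norm_bound hE hF hQ
  refine le_csSup ⟨K, ?_⟩ ⟨z, hz, rfl⟩
  rintro _ ⟨z, hz, rfl⟩
  exact hK z hz

theorem norm_apply_le_supNorm_mul (hE : IsComplexBanachLattice E)
    (hF : IsComplexBanachLattice F) {Q : regPoly m E F} (hQ : Q ∈ regPolyPos m E F) (z : E) :
    ‖(Q : E → F) z‖ ≤ supNorm (Q : E → F) * ‖z‖ ^ m := by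
  -- This also holds at `z = 0`, where the inverse is `0`.
  have hz : z = (‖z‖ : ℂ) • (‖z‖ : ℂ)⁻¹ • z := by
    rcases eq_or_ne z 0 with rfl | hz
    · simp
    · rw [smul_smul, mul_inv_cancel₀, one_smul]
      exact Complex.ofReal_ne_zero.2 fun h => hz ((hE.isBanach.core.norm_eq_zero_iff z).1 h)
  have hn := hE.isBanach.core.norm_nonneg z
  have h1 : ‖(‖z‖ : ℂ)⁻¹ • z‖ ≤ 1 := by
    rw [hE.isBanach.core.norm_smul, norm_inv, Complex.norm_real, Real.norm_of_nonneg hn]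
    exact inv_mul_le_one
  conv_lhs => rw [hz]
  rw [regPoly_apply_smul, hF.isBanach.core.norm_smul, norm_pow, Complex.norm_real,
    Real.norm_of_nonneg hn, mul_comm]
  exact mul_le_mul_of_nonneg_right (norm_apply_le_supNorm hE hF hQ h1) (pow_nonneg hn m)

theorem supNorm_le (hE : IsComplexBanachLattice E) {P : E → F} {K : ℝ}
    (h : ∀ z : E, ‖z‖ ≤ 1 → ‖P z‖ ≤ K) : supNorm P ≤ K := by
  refine csSup_le ⟨_, 0, ?_, rfl⟩ ?_
  · rw [(hE.isBanach.core.norm_eq_zero_iff 0).2 rfl]; exact zero_le_one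
  · rintro _ ⟨z, hz, rfl⟩
    exact h z hz

theorem supNorm_nonneg (hF : IsComplexBanachLattice F) (P : E → F) : 0 ≤ supNorm P := by
  refine Real.sSup_nonneg ?_
  rintro _ ⟨z, -, rfl⟩
  exact hF.isBanach.core.norm_nonneg _

theorem supNorm_le_supNorm (hE : IsComplexBanachLattice E) (hF : IsComplexBanachLattice F)
    {P Q : regPoly m E F} (hP : P ∈ regPolyPos m E F) (hPQ : Q - P ∈ regPolyPos m E F) :
    supNorm (P : E → F) ≤ supNorm (Q : E → F) := by
  have hQ : Q ∈ regPolyPos m E F := by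
    have := (regPolyPos m E F).add_mem hPQ hP
    rwa [sub_add_cancel] at this
  refine supNorm_le hE fun z hz => ?_
  obtain ⟨w, hw, hm, hn⟩ := hE.exists_isModulus z
  exact (norm_apply_le_norm_apply hE hF ((Dominates.of_mem hP).mono hPQ) hm.dominates).trans
    (norm_apply_le_supNorm hE hF hQ (hn.trans_le hz))

theorem regNorm_le_supNorm (hE : IsComplexBanachLattice E) (hF : IsComplexBanachLattice F)
    (hD : IsDedekindComplete F) {P Q : regPoly m E F} (h : Dominates (regPolyPos m E F) P Q) :
    regNorm m E F P ≤ supNorm (Q : E → F) := by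
  obtain ⟨M, hM⟩ := regPoly_exists_isModulus hE hF hD P
  rw [regNorm_eq hE hF hM]
  exact supNorm_le_supNorm hE hF hM.dominates.mem
    (hM.sub_mem h (regPoly_eq_zero_of_I_smul hE hF))

theorem regPoly_isContHomPoly (hE : IsComplexBanachLattice E) (hF : IsComplexBanachLattice F)
    (hD : IsDedekindComplete F) (P : regPoly m E F) : IsContHomPoly m E F (P : E → F) := by
  obtain ⟨Q, hQ⟩ := regPoly_exists_isModulus hE hF hD P
  refine ⟨⟨_, generates_polarForm P⟩, supNorm (Q : E → F), fun z => ?_⟩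
  obtain ⟨w, hw, hm, hn⟩ := hE.exists_isModulus z
  rw [← hn]
  exact (norm_apply_le_norm_apply hE hF hQ.dominates hm.dominates).trans
    (norm_apply_le_supNorm_mul hE hF hQ.dominates.mem w)

end Regular

section Regular

variable {m k : ℕ} {E F : ConeSpace.{u}}

/-! ### Completeness of the regular norm -/

/-- `S` is the pointwise sum. The last clause is what transfers symmetry from the terms to the sum.
-/
theorem IsBanach.exists_multilinear_sum (hF : IsBanach F) {ι : Type}
    (A : ℕ → MultilinearMap ℂ (fun _ : ι => E) F)
    (h : ∀ x, Summable fun n => ‖A n x‖) :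
    ∃ S : MultilinearMap ℂ (fun _ : ι => E) F,
      (∀ x n, ‖S x - ∑ i ∈ Finset.range n, A i x‖ ≤ ∑' i, ‖A (i + n) x‖) ∧
      ∀ x y, (∀ n, A n x = A n y) → S x = S y := by
  let _ : NormedAddCommGroup F.carrier := NormedAddCommGroup.ofCore hF.core
  let _ : NormedSpace ℂ F.carrier := NormedSpace.ofCore hF.core
  have _ : CompleteSpace F.carrier := Metric.complete_of_cauchySeq_tendsto fun s hs => by
    obtain ⟨l, hl⟩ := hF.complete s fun ε hε => by
      obtain ⟨N, hN⟩ := Metric.cauchySeq_iff.1 hs ε hε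
      exact ⟨N, fun i hi j hj => by rw [← dist_eq_norm]; exact hN i hi j hj⟩
    refine ⟨l, Metric.tendsto_atTop.2 fun ε hε => ?_⟩
    obtain ⟨N, hN⟩ := hl ε hε
    exact ⟨N, fun i hi => by rw [dist_eq_norm]; exact hN i hi⟩
  have hs : ∀ x, Summable fun n => A n x := fun x => (h x).of_norm
  refine ⟨{ toFun := fun x => ∑' n, A n x
            map_update_add' := fun x i a b => ?_
            map_update_smul' := fun x i c a => ?_ }, fun x n => ?_, fun x y hxy => ?_⟩
  · rw [← (hs _).tsum_add (hs _)]
    exact tsum_congr fun n => (A n).map_update_add x i a b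
  · rw [← (hs _).tsum_const_smul c]
    exact tsum_congr fun n => (A n).map_update_smul x i c a
  · have h1 := (hasSum_nat_add_iff' n).2 (hs x).hasSum
    have h2 := ((summable_nat_add_iff n).2 (h x)).hasSum
    exact h1.norm_le_of_bounded h2 fun i => le_rfl
  · exact tsum_congr hxy

/-- Replacing every argument by `∑ |xᵢ|` increases a positive form and lands on the diagonal; `K`
depends on `x` but not on `P`. -/
theorem norm_polarForm_le (hE : IsComplexBanachLattice E) (hF : IsComplexBanachLattice F)
    (x : Fin m → E) :
    ∃ K : ℝ, 0 ≤ K ∧ ∀ {P : regPoly m E F}, P ∈ regPolyPos m E F →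
      ‖polarForm P x‖ ≤ supNorm (P : E → F) * K := by
  choose w hw hm hn using fun i => hE.exists_isModulus (x i)
  refine ⟨‖∑ i, w i‖ ^ m, pow_nonneg (hE.isBanach.core.norm_nonneg _) m, fun {P} hP => ?_⟩
  refine le_trans (hF.norm_le_of_dominates ?_) (norm_apply_le_supNorm_mul hE hF hP (∑ i, w i))
  have h1 := (Dominates.of_mem hP).polarForm_apply hE hF fun i => (hm i).dominates
  rw [← polarForm_diag]
  refine h1.mono (map_sub_map_mem_of_mem_positiveMaps (mem_regPolyPos_iff.1 hP) hw fun i => ?_)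
  rw [← Finset.add_sum_erase _ _ (Finset.mem_univ i), add_sub_cancel_left]
  exact sum_mem fun j _ => hw j

/-- The polar forms are summed pointwise. Remainders are limits of positive sums, hence positive, so
their regular norm is a supremum norm, bounded by the tail of the norm series. -/
theorem regPoly_series (hE : IsComplexBanachLattice E) (hF : IsComplexBanachLattice F)
    (c : ℕ → regPoly m E F) (hc : ∀ n, c n ∈ regPolyPos m E F)
    (hs : Summable fun n => regNorm m E F (c n)) :
    ∃ s : regPoly m E F, (∀ n, s - ∑ i ∈ Finset.range n, c i ∈ regPolyPos m E F) ∧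
      Filter.Tendsto (fun n => regNorm m E F (s - ∑ i ∈ Finset.range n, c i)) Filter.atTop
        (nhds 0) := by
  replace hs : Summable fun n => supNorm (c n : E → F) :=
    hs.congr fun n => regNorm_of_mem hE hF (hc n)
  have hsum : ∀ x, Summable fun n => ‖polarForm (c n) x‖ := fun x => by
    obtain ⟨K, hK, h⟩ := norm_polarForm_le (m := m) hE hF x
    exact Summable.of_nonneg_of_le (fun n => hF.isBanach.core.norm_nonneg _) (fun n => h (hc n))
      (hs.mul_right K)
  obtain ⟨S, hS, hS'⟩ := hF.isBanach.exists_multilinear_sum (fun n => polarForm (c n)) hsum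
  have hpos : ∀ n, ∀ x : Fin m → E, (∀ i, x i ∈ E.pos) →
      S x - ∑ i ∈ Finset.range n, polarForm (c i) x ∈ F.pos := by
    intro n x hx
    refine hF.mem_pos_of_approx fun ε hε => ?_
    have ht := tendsto_sum_nat_add fun i => ‖polarForm (c i) x‖
    obtain ⟨N, hN, hnN⟩ := ((ht.eventually (gt_mem_nhds hε)).and
      (Filter.eventually_ge_atTop n)).exists
    refine ⟨∑ i ∈ Finset.range N, polarForm (c i) x - ∑ i ∈ Finset.range n, polarForm (c i) x,
      ?_, ?_⟩
    · rw [← Finset.sum_Ico_eq_sub _ hnN]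
      exact sum_mem fun i _ => mem_regPolyPos_iff.1 (hc i) x hx
    · rw [sub_sub_sub_cancel_right]
      exact (hS x N).trans_lt hN
  obtain ⟨s, -, hs'⟩ := exists_polarForm_eq (A := S) (fun π x => hS' _ _ fun n =>
    (generates_polarForm (c n)).1 π x) fun x hx => by simpa using hpos 0 x hx
  have hval : ∀ n x, polarForm (s - ∑ i ∈ Finset.range n, c i) x =
      S x - ∑ i ∈ Finset.range n, polarForm (c i) x := fun n x => by
    rw [map_sub, map_sum, hs', sub_apply, sum_apply]
  have hmem : ∀ n, s - ∑ i ∈ Finset.range n, c i ∈ regPolyPos m E F := fun n =>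
    mem_regPolyPos_iff.2 fun x hx => by rw [hval]; exact hpos n x hx
  refine ⟨s, hmem, ?_⟩
  have hle : ∀ n, supNorm ((s - ∑ i ∈ Finset.range n, c i : regPoly m E F) : E → F) ≤
      ∑' i, supNorm (c (i + n) : E → F) := by
    intro n
    refine supNorm_le hE fun z hz => ?_
    rw [← polarForm_diag, hval]
    refine (hS _ n).trans ?_
    have hterm : ∀ i, ‖polarForm (c (i + n)) fun _ => z‖ ≤ supNorm (c (i + n) : E → F) :=
      fun i => by
        rw [polarForm_diag]
        exact norm_apply_le_supNorm hE hF (hc _) hz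
    have h1 : Summable fun i => ‖polarForm (c (i + n)) fun _ => z‖ :=
      (summable_nat_add_iff (f := fun i => ‖polarForm (c i) fun _ => z‖) n).2 (hsum _)
    have h2 : Summable fun i => supNorm (c (i + n) : E → F) :=
      (summable_nat_add_iff (f := fun i => supNorm (c i : E → F)) n).2 hs
    exact h1.tsum_le_tsum hterm h2
  have hlim := squeeze_zero (fun n => supNorm_nonneg hF _) hle
    (tendsto_sum_nat_add fun i => supNorm (c i : E → F))
  exact hlim.congr fun n => (regNorm_of_mem hE hF (hmem n)).symm

/-- The regular polynomials form a complex Banach lattice. -/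
theorem regularPolynomials_isComplexBanachLattice (hE : IsComplexBanachLattice E)
    (hF : IsComplexBanachLattice F) (hD : IsDedekindComplete F) :
    IsComplexBanachLattice (regularPolynomials E F m).toConeSpace := by
  have hnorm : ∀ P ∈ regPolyPos m E F, regNorm m E F P = supNorm (P : E → F) :=
    fun P hP => regNorm_of_mem hE hF hP
  refine isComplexBanachLattice_of_cone (regularPolynomials E F m).toConeSpace
    (regPoly_salient hE hF) (regPoly_eq_zero_of_I_smul hE hF) regPoly_exists_re_im
    (regPoly_isOrderComplete hE hF hD) (fun (P : regPoly m E F) hP (Q : regPoly m E F) hPQ => ?_)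
    (fun (P : regPoly m E F) hP (Q : regPoly m E F) hQ => ?_)
    (fun t ht (P : regPoly m E F) hP => ?_) (fun (P : regPoly m E F) hP h => ?_)
    (fun (P Q : regPoly m E F) h => ?_) (regPoly_series hE hF)
  · change regNorm m E F P ≤ regNorm m E F Q
    have hQ : Q ∈ regPolyPos m E F := by
      have hPQ' : Q - P ∈ regPolyPos m E F := hPQ
      have := (regPolyPos m E F).add_mem hPQ' hP
      rwa [sub_add_cancel] at this
    rw [hnorm P hP, hnorm Q hQ]
    exact supNorm_le_supNorm hE hF hP hPQ
  · change regNorm m E F (P + Q) ≤ regNorm m E F P + regNorm m E F Q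
    rw [hnorm P hP, hnorm Q hQ, hnorm _ ((regPolyPos m E F).add_mem hP hQ)]
    refine supNorm_le hE fun z hz => ?_
    exact (hF.isBanach.core.norm_triangle _ _).trans
      (add_le_add (norm_apply_le_supNorm hE hF hP hz) (norm_apply_le_supNorm hE hF hQ hz))
  · change regNorm m E F (t • P) = t * regNorm m E F P
    rw [hnorm P hP, hnorm _ ((regPolyPos m E F).smul_mem ht hP)]
    have hv : ∀ z, ‖((t • P : regPoly m E F) : E → F) z‖ = t * ‖(P : E → F) z‖ := fun z => by
      have := hF.isBanach.core.norm_smul (t : ℂ) ((P : E → F) z)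
      rwa [Complex.norm_real, Real.norm_of_nonneg ht] at this
    refine le_antisymm (supNorm_le hE fun z hz => ?_) ?_
    · rw [hv]
      exact mul_le_mul_of_nonneg_left (norm_apply_le_supNorm hE hF hP hz) ht
    · rcases ht.eq_or_lt with rfl | ht'
      · rw [zero_mul]; exact supNorm_nonneg hF _
      · rw [← le_div_iff₀' ht']
        refine supNorm_le hE fun z hz => ?_
        rw [le_div_iff₀' ht', ← hv]
        exact norm_apply_le_supNorm hE hF ((regPolyPos m E F).smul_mem ht hP) hz
  · change regNorm m E F P = 0 at h
    rw [hnorm P hP] at h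
    refine Subtype.ext (funext fun z => ?_)
    have := norm_apply_le_supNorm_mul hE hF hP z
    rw [h, zero_mul] at this
    exact (hF.isBanach.core.norm_eq_zero_iff _).1
      (le_antisymm this (hF.isBanach.core.norm_nonneg _))
  · change regNorm m E F P = regNorm m E F Q
    rw [regNorm_eq hE hF h, hnorm Q h.dominates.mem]

theorem regularPolynomials_isDedekindComplete (hE : IsComplexBanachLattice E)
    (hF : IsComplexBanachLattice F) (hD : IsDedekindComplete F) :
    IsDedekindComplete (regularPolynomials E F m).toConeSpace := by
  rintro S hS hne ⟨b, -, hb⟩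
  obtain ⟨w, hw⟩ := regPoly_isOrderComplete (m := m) hE hF hD S hne b hb
  exact ⟨w, hw.mem_realSpan hS hne, hw⟩

/-! ### Constants -/

theorem mem_regPoly_zero_iff (hF : IsComplexBanachLattice F) {P : E → F} :
    P ∈ regPoly 0 E F ↔ ∃ c : F, P = fun _ => c := by
  constructor
  · intro hP
    refine ⟨polarForm ⟨P, hP⟩ 0, funext fun x => ?_⟩
    refine (polarForm_diag ⟨P, hP⟩ x).symm.trans ?_
    exact congrArg _ (Subsingleton.elim _ _)
  · rintro ⟨c, rfl⟩
    have key : ∀ c ∈ F.pos, (fun _ => c) ∈ posPoly 0 E F := fun c hc =>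
      ⟨MultilinearMap.constOfIsEmpty ℂ _ c, ⟨fun _ _ => rfl, fun _ => rfl⟩, fun _ _ => hc⟩
    obtain ⟨x, hx, y, hy, rfl⟩ := hF.exists_re_im c
    obtain ⟨a, ha, b, hb, rfl⟩ := mem_realSpan_iff.1 hx
    obtain ⟨c, hc, d, hd, rfl⟩ := mem_realSpan_iff.1 hy
    exact ⟨fun _ => a - b, fun _ => c - d, ⟨_, key a ha, _, key b hb, rfl⟩,
      ⟨_, key c hc, _, key d hd, rfl⟩, rfl⟩

theorem supNorm_const (hE : IsComplexBanachLattice E) (c : F) :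
    supNorm (fun _ : E => c) = ‖c‖ := by
  refine le_antisymm (supNorm_le hE fun _ _ => le_rfl) (le_csSup ⟨‖c‖, ?_⟩ ⟨0, ?_, rfl⟩)
  · rintro _ ⟨z, -, rfl⟩
    exact le_rfl
  · rw [(hE.isBanach.core.norm_eq_zero_iff 0).2 rfl]; exact zero_le_one

/-- The constant `|c|` dominates `P`, which bounds the norm above; the modulus of `P` is itself a
constant dominating `c`, which bounds it below. -/
theorem regNorm_const (hE : IsComplexBanachLattice E) (hF : IsComplexBanachLattice F)
    (hD : IsDedekindComplete F) (P : regPoly 0 E F) (c : F) (hP : (P : E → F) = fun _ => c) :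
    regNorm 0 E F P = ‖c‖ := by
  apply le_antisymm
  · obtain ⟨w, hw, hm, hn⟩ := hF.exists_isModulus c
    let Q : regPoly 0 E F := ⟨fun _ => w, (mem_regPoly_zero_iff hF).2 ⟨w, rfl⟩⟩
    have hPQ : Dominates (regPolyPos 0 E F) P Q := (regPoly_dominates_iff hF).2 fun x _ => by
      rw [Subsingleton.elim x fun _ => 0, polarForm_diag, polarForm_diag, hP]
      exact hm.dominates
    rw [← hn, ← supNorm_const hE w]
    exact regNorm_le_supNorm hE hF hD hPQ
  · obtain ⟨M, hM⟩ := regPoly_exists_isModulus hE hF hD P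
    obtain ⟨d, hd⟩ := (mem_regPoly_zero_iff hF).1 M.2
    rw [regNorm_eq hE hF hM, hd, supNorm_const hE]
    have := norm_apply_le_norm_apply hE hF hM.dominates (Dominates.of_mem E.pos.zero_mem)
    rwa [hP, hd] at this

end Regular

section Derivative

variable {m k : ℕ} {E F : ConeSpace.{u}}

/-! ### Derivatives of regular polynomials -/

theorem regPoly_induction {p : regPoly m E F → Prop} (hpos : ∀ P ∈ regPolyPos m E F, p P)
    (hadd : ∀ P Q, p P → p Q → p (P + Q)) (hsmul : ∀ (c : ℂ) (P), p P → p (c • P))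
    (P : regPoly m E F) : p P := by
  have key : ∀ P ∈ realSpan (regPolyPos m E F), p P := by
    intro P hP
    obtain ⟨a, ha, b, hb, rfl⟩ := mem_realSpan_iff.1 hP
    rw [sub_eq_add_neg, ← neg_one_smul ℂ b]
    exact hadd _ _ (hpos a ha) (hsmul _ _ (hpos b hb))
  obtain ⟨P₀, h0, P₁, h1, rfl⟩ := regPoly_exists_re_im P
  exact hadd _ _ (key _ h0) (hsmul _ _ (key _ h1))

/-- The first `m - k` and the last `k` of `m` indices. -/
def splitIndex (hk : k ≤ m) : Fin (m - k) ⊕ Fin k ≃ Fin m :=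
  finSumFinEquiv.trans (finCongr (Nat.sub_add_cancel hk))

/-- The multilinear map `a ↦ (y ↦ A (a, y))`. -/
def partialForm (hk : k ≤ m) (A : MultilinearMap ℂ (fun _ : Fin m => E) F) :
    MultilinearMap ℂ (fun _ : Fin (m - k) => E) (MultilinearMap ℂ (fun _ : Fin k => E) F) :=
  (A.domDomCongr (splitIndex hk).symm).currySum

theorem partialForm_apply (hk : k ≤ m) (A : MultilinearMap ℂ (fun _ : Fin m => E) F)
    (a : Fin (m - k) → E) (y : Fin k → E) :
    partialForm hk A a y = A fun i => Sum.elim a y ((splitIndex hk).symm i) := rfl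

/-- The multilinear map `a ↦ (y ↦ A (a, y, …, y))`, with values in the functions of `y`. -/
def partialDiag (hk : k ≤ m) (A : MultilinearMap ℂ (fun _ : Fin m => E) F) :
    MultilinearMap ℂ (fun _ : Fin (m - k) => E) (E → F) :=
  LinearMap.compMultilinearMap
    { toFun := fun B x => B fun _ => x
      map_add' := fun _ _ => rfl
      map_smul' := fun _ _ => rfl } (partialForm hk A)

theorem generates_partialDiag (hk : k ≤ m) {A : MultilinearMap ℂ (fun _ : Fin m => E) F}
    (hA : ∀ (π : Equiv.Perm (Fin m)) (x : Fin m → E), A (fun i => x (π i)) = A x)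
    (a : Fin (m - k) → E) : Generates (partialForm hk A a) (partialDiag hk A a) := by
  refine ⟨fun π y => ?_, fun y => rfl⟩
  rw [partialForm_apply, partialForm_apply]
  refine Eq.trans ?_ (hA (((splitIndex hk).symm.trans (Equiv.sumCongr (Equiv.refl _) π)).trans
    (splitIndex hk)) _)
  congr 1
  ext i
  simp only [Equiv.trans_apply, Equiv.symm_apply_apply]
  rcases (splitIndex hk).symm i with j | j <;> rfl

theorem partialForm_symm (hk : k ≤ m) {A : MultilinearMap ℂ (fun _ : Fin m => E) F}
    (hA : ∀ (π : Equiv.Perm (Fin m)) (x : Fin m → E), A (fun i => x (π i)) = A x)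
    (π : Equiv.Perm (Fin (m - k))) (a : Fin (m - k) → E) :
    partialForm hk A (fun i => a (π i)) = partialForm hk A a := by
  ext y
  rw [partialForm_apply, partialForm_apply]
  refine Eq.trans ?_ (hA (((splitIndex hk).symm.trans (Equiv.sumCongr π (Equiv.refl _))).trans
    (splitIndex hk)) _)
  congr 1
  ext i
  simp only [Equiv.trans_apply, Equiv.symm_apply_apply]
  rcases (splitIndex hk).symm i with j | j <;> rfl

theorem partialForm_mem (hk : k ≤ m) {A : MultilinearMap ℂ (fun _ : Fin m => E) F}
    (hA : A ∈ positiveMaps (Fin m) E F.pos) {a : Fin (m - k) → E} (ha : ∀ i, a i ∈ E.pos) :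
    partialForm hk A a ∈ positiveMaps (Fin k) E F.pos := by
  intro y hy
  rw [partialForm_apply]
  refine hA _ fun i => ?_
  rcases (splitIndex hk).symm i with j | j
  exacts [ha j, hy j]

theorem partialDiag_mem_posPoly (hk : k ≤ m) {P : regPoly m E F} (hP : P ∈ regPolyPos m E F)
    {a : Fin (m - k) → E} (ha : ∀ i, a i ∈ E.pos) :
    partialDiag hk (polarForm P) a ∈ posPoly k E F :=
  (generates_partialDiag hk (generates_polarForm P).1 a).mem_posPoly_iff.2
    (partialForm_mem hk (mem_regPolyPos_iff.1 hP) ha)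

/-- For positive `P` and `a` the result is a positive polynomial. Since the positive vectors span
`E` over `ℂ`, multilinearity extends this to all `a`, and linearity to all `P`. -/
theorem partialDiag_mem_regPoly (hE : IsComplexBanachLattice E) (hk : k ≤ m) (P : regPoly m E F)
    (a : Fin (m - k) → E) : partialDiag hk (polarForm P) a ∈ regPoly k E F := by
  induction P using regPoly_induction with
  | hpos P hP =>
    exact (partialDiag hk (polarForm P)).mem_of_span _ hE.span_pos _
      (fun x hx => posPoly_le_regPoly (partialDiag_mem_posPoly hk hP hx)) a
  | hadd P Q hP hQ => rw [map_add]; exact add_mem hP hQ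
  | hsmul c P hP => rw [map_smul]; exact Submodule.smul_mem _ c hP

/-- The multilinear map `a ↦ (y ↦ A (a, y, …, y))`, with values in the regular polynomials, where
`A` generates `P`. -/
noncomputable def partialPoly (hE : IsComplexBanachLattice E) (hk : k ≤ m) (P : regPoly m E F) :
    MultilinearMap ℂ (fun _ : Fin (m - k) => E) (regPoly k E F) :=
  (partialDiag hk (polarForm P)).codRestrict (regPoly k E F) (partialDiag_mem_regPoly hE hk P)

theorem polarForm_partialPoly (hE : IsComplexBanachLattice E) (hk : k ≤ m) (P : regPoly m E F)
    (a : Fin (m - k) → E) :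
    polarForm (partialPoly hE hk P a) = partialForm hk (polarForm P) a :=
  polarForm_eq (generates_partialDiag hk (generates_polarForm P).1 a)

theorem partialPoly_dominates (hE : IsComplexBanachLattice E) (hF : IsComplexBanachLattice F)
    (hk : k ≤ m) {P Q : regPoly m E F} (h : Dominates (regPolyPos m E F) P Q)
    {a b : Fin (m - k) → E} (hab : ∀ i, Dominates E.pos (a i) (b i)) :
    Dominates (regPolyPos k E F) (partialPoly hE hk P a) (partialPoly hE hk Q b) := by
  refine (regPoly_dominates_iff hF).2 fun x hx => ?_
  rw [polarForm_partialPoly, polarForm_partialPoly, partialForm_apply, partialForm_apply]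
  refine h.polarForm_apply hE hF fun i => ?_
  rcases (splitIndex hk).symm i with j | j
  exacts [hab j, Dominates.of_mem (hx j)]

/-- The map `a ↦ A (a, …, a, ·, …, ·)` as an element of the space of functions from `E` to the
space of regular polynomials. -/
noncomputable def partialFun (hE : IsComplexBanachLattice E) (hk : k ≤ m) (P : regPoly m E F) :
    E → (regularPolynomials E F k).toConeSpace :=
  fun a => partialPoly hE hk P fun _ => a

theorem partialFun_mem_regPoly (hE : IsComplexBanachLattice E) (hk : k ≤ m)
    (P : regPoly m E F) :
    partialFun hE hk P ∈ regPoly (m - k) E (regularPolynomials E F k).toConeSpace := by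
  induction P using regPoly_induction with
  | hpos P hP =>
    refine posPoly_le_regPoly ⟨partialPoly hE hk P, ⟨fun π a => ?_, fun a => rfl⟩, fun a ha => ?_⟩
    · refine Subtype.ext (funext fun y => ?_)
      exact congrArg (fun B => B fun _ => y)
        (partialForm_symm hk (generates_polarForm P).1 π a)
    · exact partialDiag_mem_posPoly hk hP ha
  | hadd P Q hP hQ =>
    have : partialFun hE hk (P + Q) = partialFun hE hk P + partialFun hE hk Q := by
      refine funext fun a => Subtype.ext (funext fun y => ?_)
      change polarForm (P + Q) _ = polarForm P _ + polarForm Q _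
      rw [map_add]; rfl
    rw [this]; exact add_mem hP hQ
  | hsmul c P hP =>
    have : partialFun hE hk (c • P) = c • partialFun hE hk P := by
      refine funext fun a => Subtype.ext (funext fun y => ?_)
      change polarForm (c • P) _ = c • polarForm P _
      rw [map_smul]; rfl
    rw [this]; exact Submodule.smul_mem _ c hP

/-! ### Norm estimates for the derivatives. -/

theorem supNorm_partialPoly_le (hE : IsComplexBanachLattice E) (hF : IsComplexBanachLattice F)
    (hk : k ≤ m) {Q : regPoly m E F} (hQ : Q ∈ regPolyPos m E F) {w : E} (hw : w ∈ E.pos)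
    (hw1 : ‖w‖ ≤ 1) {z : E} (hz : ‖z‖ ≤ 1) :
    ‖((partialPoly hE hk Q fun _ => w : regPoly k E F) : E → F) z‖ ≤
      supNorm (Q : E → F) * 2 ^ m := by
  obtain ⟨v, hv, hm, hn⟩ := hE.exists_isModulus z
  have h1 := norm_apply_le_norm_apply hE hF (partialPoly_dominates hE hF hk (Dominates.of_mem hQ)
    (a := fun _ => w) fun _ => Dominates.of_mem hw) hm.dominates
  have h2 : ((partialPoly hE hk Q fun _ => w : regPoly k E F) : E → F) v =
    polarForm Q fun i => Sum.elim (fun _ => w) (fun _ => v) ((splitIndex hk).symm i) := rfl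
  rw [h2] at h1
  have hmem : ∀ i, Sum.elim (fun _ => w) (fun _ => v) ((splitIndex hk).symm i) ∈ E.pos := fun i => by
    rcases (splitIndex hk).symm i with j | j
    exacts [hw, hv]
  -- Monotonicity moves all arguments up to `w + v`, of norm at most `2`; the factor `2 ^ m` comes
  -- from here.
  have h3 := map_sub_map_mem_of_mem_positiveMaps (mem_regPolyPos_iff.1 hQ) (y := fun _ => w + v)
    hmem fun i => by
      rcases (splitIndex hk).symm i with j | j
      · simpa using hv
      · simpa using hw
  have h4 := hF.norm_le_norm (mem_regPolyPos_iff.1 hQ _ hmem) h3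
  rw [polarForm_diag] at h4
  refine (h1.trans h4).trans ((norm_apply_le_supNorm_mul hE hF hQ (w + v)).trans ?_)
  refine mul_le_mul_of_nonneg_left ?_ (supNorm_nonneg hF _)
  refine pow_le_pow_left₀ (hE.isBanach.core.norm_nonneg _) ?_ m
  have := hE.isBanach.core.norm_triangle w v
  linarith

/-- Passing to `Q = |P|` and `w = |a|` changes neither norm, and normalizing `w` extracts the factor
`‖a‖ ^ (m - k)`. -/
theorem regNorm_partialPoly_le (hE : IsComplexBanachLattice E) (hF : IsComplexBanachLattice F)
    (hD : IsDedekindComplete F) (hk : k ≤ m) (P : regPoly m E F) (a : E) (c : ℂ) :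
    regNorm k E F (c • partialPoly hE hk P fun _ => a) ≤
      ‖c‖ * (2 ^ m * regNorm m E F P * ‖a‖ ^ (m - k)) := by
  obtain ⟨Q, hQ⟩ := regPoly_exists_isModulus hE hF hD P
  have hQp := hQ.dominates.mem
  obtain ⟨w, hw, hm, hn⟩ := hE.exists_isModulus a
  have hnE := hE.isBanach.core.norm_nonneg
  have h1 := (partialPoly_dominates hE hF hk hQ.dominates (a := fun _ => a) fun _ =>
    hm.dominates).smul c
  refine (regNorm_le_supNorm hE hF hD h1).trans (supNorm_le hE fun z hz => ?_)
  have hw' : w = (‖w‖ : ℂ) • (‖w‖ : ℂ)⁻¹ • w := by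
    rcases eq_or_ne w 0 with h | h
    · rw [h]; simp
    · rw [smul_smul, mul_inv_cancel₀, one_smul]
      exact Complex.ofReal_ne_zero.2 fun h' => h ((hE.isBanach.core.norm_eq_zero_iff w).1 h')
  set w' := (‖w‖ : ℂ)⁻¹ • w with hw'_def
  have hw'mem : w' ∈ E.pos := by
    rw [hw'_def, ← Complex.ofReal_inv]
    exact E.pos.smul_mem (inv_nonneg.2 (hnE w)) hw
  have hw'1 : ‖w'‖ ≤ 1 := by
    rw [hw'_def, hE.isBanach.core.norm_smul, norm_inv, Complex.norm_real,
      Real.norm_of_nonneg (hnE w)]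
    exact inv_mul_le_one
  have h2 : (partialPoly hE hk Q fun _ => w) =
      (‖w‖ : ℂ) ^ (m - k) • partialPoly hE hk Q fun _ => w' := by
    conv_lhs => rw [hw']
    have := (partialPoly hE hk Q).map_smul_univ (fun _ => (‖w‖ : ℂ)) fun _ => w'
    rwa [Finset.prod_const, Finset.card_univ, Fintype.card_fin] at this
  have h3 : ((‖c‖ • partialPoly hE hk Q fun _ => w : regPoly k E F) : E → F) z =
      (‖c‖ : ℂ) • (‖w‖ : ℂ) ^ (m - k) •
        ((partialPoly hE hk Q fun _ => w' : regPoly k E F) : E → F) z := by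
    rw [h2]; rfl
  rw [h3, hF.isBanach.core.norm_smul, hF.isBanach.core.norm_smul, norm_pow, Complex.norm_real,
    Complex.norm_real, norm_norm, Real.norm_of_nonneg (hnE w), hn, regNorm_eq hE hF hQ]
  refine mul_le_mul_of_nonneg_left ?_ (norm_nonneg c)
  have h4 := supNorm_partialPoly_le hE hF hk hQp hw'mem hw'1 hz
  rw [mul_comm, mul_comm (2 ^ m)]
  exact mul_le_mul_of_nonneg_right h4 (pow_nonneg (hnE a) _)

theorem four_pow_le (m : ℕ) : (2 : ℝ) ^ m * 2 ^ m ≤ (2 * Real.exp 1) ^ m := by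
  rw [← mul_pow]
  refine pow_le_pow_left₀ (by norm_num) ?_ m
  have := Real.add_one_le_exp 1
  linarith

theorem polyDeriv_eq (hE : IsComplexBanachLattice E) (hk : k ≤ m) (P : regPoly m E F) (a y : E) :
    polyDeriv k (polarForm P) a y =
      (m.descFactorial k : ℂ) • ((partialPoly hE hk P fun _ => a : regPoly k E F) : E → F) y := by
  change _ = (m.descFactorial k : ℂ) • polarForm P fun i =>
    Sum.elim (fun _ => a) (fun _ => y) ((splitIndex hk).symm i)
  rw [polyDeriv]
  congr 2
  ext i
  -- The left block occupies the positions below `m - k`, which is the test in `polyDeriv`.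
  obtain ⟨j, rfl⟩ := (splitIndex hk).surjective i
  rw [Equiv.symm_apply_apply]
  rcases j with j | j
  · have : ((splitIndex hk (Sum.inl j) : Fin m) : ℕ) = j := rfl
    rw [this, if_pos j.2]; rfl
  · have : ((splitIndex hk (Sum.inr j) : Fin m) : ℕ) = m - k + j := rfl
    rw [this, if_neg (by omega)]; rfl

end Derivative

theorem proposition4p4 :
    IsHolomorphyType.{u} LatticePair.{u} regularPolynomials.{u} (2 * Real.exp 1) where
  banach_pair := fun E F h => ⟨h.1.isBanach, h.2.1.isBanach⟩
  banach := fun E F h m => (regularPolynomials_isComplexBanachLattice h.1 h.2.1 h.2.2).isBanach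
  subspace := fun E F h m P hP => regPoly_isContHomPoly h.1 h.2.1 h.2.2 ⟨P, hP⟩
  zero_mem := fun E F h P => mem_regPoly_zero_iff h.2.1
  zero_norm := fun E F h P c hP => regNorm_const h.1 h.2.1 h.2.2 P c hP
  closed := fun E F h k => ⟨h.1, regularPolynomials_isComplexBanachLattice h.1 h.2.1 h.2.2,
    regularPolynomials_isDedekindComplete h.1 h.2.1 h.2.2⟩
  one_le := by
    have := Real.add_one_le_exp 1
    linarith
  deriv := by
    rintro E F ⟨hE, hF, hD⟩ m k hk P A hA
    change regPoly m E F at P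
    -- By polarization the given `A` is the only possible generator.
    obtain rfl : polarForm P = A := polarForm_eq hA
    refine ⟨(m.descFactorial k : ℂ) • partialFun hE hk P, fun a y => ?_,
      Submodule.smul_mem _ _ (partialFun_mem_regPoly hE hk P), fun a => ?_⟩
    · exact (polyDeriv_eq hE hk P a y).symm
    · have h1 := regNorm_partialPoly_le hE hF hD hk P a
        ((1 / (k.factorial : ℂ)) * (m.descFactorial k : ℂ))
      -- The normalized coefficient is binomial, hence at most `2 ^ m`.
      have h2 : (1 / (k.factorial : ℂ)) * (m.descFactorial k : ℂ) = (m.choose k : ℂ) := by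
        rw [Nat.descFactorial_eq_factorial_mul_choose, Nat.cast_mul, ← mul_assoc,
          one_div_mul_cancel (Nat.cast_ne_zero.2 k.factorial_ne_zero), one_mul]
      have h3 : (m.choose k : ℝ) ≤ 2 ^ m := by exact_mod_cast Nat.choose_le_two_pow m k
      have h4 : 0 ≤ regNorm m E F P := by
        obtain ⟨Q, hQ⟩ := regPoly_exists_isModulus hE hF hD P
        rw [regNorm_eq hE hF hQ]
        exact supNorm_nonneg hF _
      have h5 : 0 ≤ ‖a‖ ^ (m - k) := pow_nonneg (hE.isBanach.core.norm_nonneg a) _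
      have h6 : regNorm k E F (((1 / (k.factorial : ℂ)) * (m.descFactorial k : ℂ)) •
          partialPoly hE hk P fun _ => a) ≤
          (2 * Real.exp 1) ^ m * regNorm m E F P * ‖a‖ ^ (m - k) := by
        refine h1.trans ?_
        rw [h2, Complex.norm_natCast]
        calc (m.choose k : ℝ) * (2 ^ m * regNorm m E F P * ‖a‖ ^ (m - k))
            ≤ 2 ^ m * (2 ^ m * regNorm m E F P * ‖a‖ ^ (m - k)) :=
              mul_le_mul_of_nonneg_right h3 (by positivity)
          _ = (2 ^ m * 2 ^ m) * (regNorm m E F P * ‖a‖ ^ (m - k)) := by ring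
          _ ≤ (2 * Real.exp 1) ^ m * (regNorm m E F P * ‖a‖ ^ (m - k)) :=
              mul_le_mul_of_nonneg_right (four_pow_le m) (by positivity)
          _ = _ := by ring
      rw [mul_smul] at h6
      exact h6
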